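/- Let $\Sigma$ be a finite cell decomposition, with at least one edge, of a connected compact oriented surface with or without boundary. Let $F$ be its set of faces and $E_0$ its set of interior edges (an interior edge may have the same face on both sides). An edge $e\in E_0$ is incident with $f\in F$ if $f$ lies on at least one side of $e$. Let $\theta^*\in(0,\pi)^{E_0}$ and $\Phi\in(0,\infty)^F$ be given. The quad graph of $\Sigma$ has one white vertex for each face of $\Sigma$, black vertices corresponding to the vertices of $\Sigma$, and one quadrilateral for each $e\in E_0$. The vertices of this quadrilateral are, in cyclic order, the white vertex of the face on one side of $e$, one endpoint of $e$, the white vertex of the face on the other side of $e$, and the other endpoint of $e$. Two sides of quadrilaterals are identified whenever the two interior edges are consecutive in the boundary of a face $f$: the common side then joins the white vertex of $f$ to the vertex of $\Sigma$ shared by the two consecutive edges. A *euclidean* (respectively *hyperbolic*) *circle pattern* (of generalized Delaunay type) with cell decomposition $\Sigma$ is a realization of this quad graph in a surface of constant curvature $0$ (respectively $-1$), possibly with cone-like singularities at the black and white vertices, such that the edges of the quad graph are geodesic and all edges incident with the same white vertex have the same length. Equivalently, the surface is glued isometrically along the sides from nondegenerate geodesic quadrilaterals, one for each $e\in E_0$,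 with vertices in the order compatible with the orientation. The edges at the white vertex of $f$ are radii of the circle of $f$. The pattern has the data $(\theta^*,\Phi)$ if for every $e\in E_0$ the circles of the two faces on the sides of $e$ have interior intersection angle $\theta^*_e$ at both black vertices of the quadrilateral of $e$ (that is, the angles of this quadrilateral at its black vertices are $\pi-\theta^*_e$), and if for every $f\in F$ the angles of the quadrilaterals at the white vertex of $f$ add up to $\Phi_f$. (For a face without boundary edges, $\Phi_f$ is the cone angle; for a boundary face, it is the Neumann boundary condition.) For $F'\subseteq F$ let $E'(F')\subseteq E_0$ be the set of all interior edges that are incident with some face in $F'$. (i) A euclidean circle pattern with cell decomposition $\Sigma$ and data $(\theta^*,\Phi)$ exists if and only if for every nonempty $F'\subseteq F$ $$\sum_{f\in F'}\Phi_f\le\sum_{e\in E'(F')}2\theta^*_e,$$ where equality holds if and only if $F'=F$. If it exists, the circle pattern is unique up to similarity: for any two such patterns there is a similarity between the surfaces which carries one pattern to the other, respecting the labelling by $\Sigma$. (ii) A hyperbolic circle pattern with cell decomposition $\Sigma$ and data $(\theta^*,\Phi)$ exists if and only if for every nonempty $F'\subseteq F$ (including $F'=F$) $$\sum_{f\in F'}\Phi_f<\sum_{e\in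 E'(F')}2\theta^*_e .$$ If it exists, the circle pattern is unique up to isometry, in the same sense. -/

import Mathlib

noncomputable section

/-! ### Cell decompositions -/

/-- A cell decomposition (with at least one edge, if `D` is nonempty and finite) of a compact
connected oriented surface with or without boundary, encoded on its set `D` of oriented edges:
`ι` reverses an oriented edge, and `σ` sends an oriented edge to the next one in the boundary of
the face on its left side.  The boundary components are capped off by discs, which are the
faces in `hole`. -/
structure CellularSurface (D : Type*) where
  ι : Equiv.Perm D
  σ : Equiv.Perm D
  ι_ι : ∀ e, ι (ι e) = e
  ι_ne : ∀ e, ι e ≠ e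
  /-- the group generated by `ι` and `σ` acts transitively: the surface is connected -/
  connected : MulAction.IsPretransitive (Subgroup.closure {ι, σ} : Subgroup (Equiv.Perm D)) D
  /-- the cycles of `σ` that are holes -/
  hole : Set (Quotient (Equiv.Perm.SameCycle.setoid σ))
  /-- no edge has holes on both sides -/
  hole_edge : ∀ e : D, (⟦e⟧ : Quotient (Equiv.Perm.SameCycle.setoid σ)) ∈ hole →
    (⟦ι e⟧ : Quotient (Equiv.Perm.SameCycle.setoid σ)) ∉ hole
  /-- around a vertex (a cycle of `ι * σ⁻¹`, the oriented edges starting there) there is at most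
  one corner of a hole, so that the complement of the holes is a surface with boundary -/
  hole_vertex : ∀ e e' : D, (ι * σ⁻¹).SameCycle e e' →
    (⟦e⟧ : Quotient (Equiv.Perm.SameCycle.setoid σ)) ∈ hole →
    (⟦e'⟧ : Quotient (Equiv.Perm.SameCycle.setoid σ)) ∈ hole → e = e'

namespace CellularSurface

/-- The set `F` of faces: the cycles of `σ` that are not holes. -/
def Face {D : Type*} (S : CellularSurface D) : Type _ :=
  {f : Quotient (Equiv.Perm.SameCycle.setoid S.σ) // f ∉ S.hole}

/-- Oriented interior edges: there is a face, not a hole, on both sides. -/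
def InteriorDart {D : Type*} (S : CellularSurface D) : Type _ :=
  {e : D // (⟦e⟧ : Quotient (Equiv.Perm.SameCycle.setoid S.σ)) ∉ S.hole ∧
    (⟦S.ι e⟧ : Quotient (Equiv.Perm.SameCycle.setoid S.σ)) ∉ S.hole}

/-- Reversal of oriented interior edges. -/
def flip {D : Type*} (S : CellularSurface D) : Equiv.Perm S.InteriorDart where
  toFun e := ⟨S.ι e.1, e.2.2, by rw [S.ι_ι]; exact e.2.1⟩
  invFun e := ⟨S.ι e.1, e.2.2, by rw [S.ι_ι]; exact e.2.1⟩
  left_inv e := Subtype.ext (S.ι_ι e.1)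
  right_inv e := Subtype.ext (S.ι_ι e.1)

/-- The set `E₀` of (unoriented) interior edges `{e, ι e}`. -/
def InteriorEdge {D : Type*} (S : CellularSurface D) : Type _ :=
  Quotient (Equiv.Perm.SameCycle.setoid S.flip)

/-- The face on the left side of an oriented interior edge. -/
def leftFace {D : Type*} (S : CellularSurface D) (e : S.InteriorDart) : S.Face :=
  ⟨Quotient.mk _ e.1, e.2.1⟩

/-- The unoriented edge of an oriented interior edge. -/
def edge {D : Type*} (S : CellularSurface D) (e : S.InteriorDart) : S.InteriorEdge :=
  Quotient.mk _ e

instance instFintypeFace {D : Type*} [Finite D] (S : CellularSurface D) : Fintype S.Face :=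
  haveI : Finite S.Face := by unfold Face; infer_instance
  Fintype.ofFinite _

instance instFintypeInteriorDart {D : Type*} [Finite D] (S : CellularSurface D) :
    Fintype S.InteriorDart :=
  haveI : Finite S.InteriorDart := by unfold InteriorDart; infer_instance
  Fintype.ofFinite _

instance instFintypeInteriorEdge {D : Type*} [Finite D] (S : CellularSurface D) :
    Fintype S.InteriorEdge :=
  haveI : Finite S.InteriorEdge := by unfold InteriorEdge; infer_instance
  Fintype.ofFinite _

open Classical in
/-- The set `E'` of all interior edges that are incident with some face in `F'`. -/
def incidentEdges {D : Type*} [Finite D] (S : CellularSurface D) (F' : Finset S.Face) :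
    Finset S.InteriorEdge :=
  Finset.univ.filter fun e => ∃ d : S.InteriorDart, S.edge d = e ∧ S.leftFace d ∈ F'

end CellularSurface

/-! ### The euclidean and the hyperbolic plane -/

/-- A common notation for the two model planes: `dir p x` is a tangent vector at `p`, in a
complex coordinate that is conformal and orientation preserving at `p`, of the geodesic ray from
`p` through `x`.  It is used only for the two instances below. -/
class ModelPlane (X : Type) [MetricSpace X] where
  dir : X → X → ℂ

/-- The euclidean plane. -/
instance instModelPlaneComplex : ModelPlane ℂ where
  dir p x := x - p

/-- The hyperbolic plane (upper half plane with Mathlib's metric, of curvature `-1`).  The Cayley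
transform `x ↦ (x - p) / (x - conj p)` onto the unit disc sends `p` to the centre, and hence the
geodesic rays from `p` to radii of the disc. -/
instance instModelPlaneUpperHalfPlane : ModelPlane UpperHalfPlane where
  dir p x := ((x : ℂ) - (p : ℂ)) / ((x : ℂ) - (starRingEnd ℂ) (p : ℂ))

namespace ModelPlane

/-- The angle in `[0, π]` at `p` between the geodesic rays from `p` through `x` and `y`. -/
def angleAt {X : Type} [MetricSpace X] [ModelPlane X] (p x y : X) : ℝ :=
  InnerProductGeometry.angle (dir p x) (dir p y)

/-- `x, y, z` are the vertices, in counterclockwise order, of a nondegenerate triangle. -/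
def PositivelyOriented {X : Type} [MetricSpace X] [ModelPlane X] (x y z : X) : Prop :=
  0 < ((starRingEnd ℂ) (dir x y) * dir x z).im

/-- The geodesic segment between `x` and `y`. -/
def seg {X : Type} [MetricSpace X] (x y : X) : Set X :=
  {z | dist x z + dist z y = dist x y}

/-- The closed geodesic triangle with vertices `x, y, z`. -/
def triangle {X : Type} [MetricSpace X] (x y z : X) : Set X :=
  {p | ∃ q ∈ seg y z, p ∈ seg x q}

end ModelPlane

open ModelPlane

/-! ### Circle patterns -/

/-- A (generalized) Delaunay type circle pattern with cell decomposition `S` in a cone surface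
modelled on the plane `X`, i.e. the quad graph of `S` with geodesic edges such that all edges at a
white vertex have the same length.  The surface is given by its quadrilaterals and is glued from
them below.

The quadrilateral of the interior edge `{e, ι e}`, placed in the plane `X`, has the vertices
`center e`, `corner e`, `center (ι e)`, `corner (ι e)` in counterclockwise order.  Here `center e`
is the white vertex that corresponds to the face on the left of `e`, and `corner e` is the black
vertex that corresponds to the initial vertex of `e`.  The quadrilateral is composed of two
triangles on either side of the diagonal between the white vertices (this diagonal lies inside the
quadrilateral since the angles at the black vertices are less than `π`). -/
structure CirclePattern (X : Type) [MetricSpace X] [ModelPlane X] {D : Type*}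
    (S : CellularSurface D) where
  center : S.InteriorDart → X
  corner : S.InteriorDart → X
  /-- Applied to `e` and to `ι e`, this says that both triangles are nondegenerate, and that they
  lie on the proper sides of their common diagonal. -/
  oriented : ∀ e, PositivelyOriented (center e) (corner e) (center (S.flip e))
  /-- All edges of the quad graph that are incident with the white vertex of a face `f` have the
  same length `r f`, the radius of the circle. -/
  equal_lengths : ∃ r : S.Face → ℝ, ∀ e,
    dist (center e) (corner e) = r (S.leftFace e) ∧
    dist (center e) (corner (S.flip e)) = r (S.leftFace e)

namespace CirclePattern

section

variable {X : Type} [MetricSpace X] [ModelPlane X] {D : Type*} {S : CellularSurface D}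

/-- The interior angle at `center e` of the quadrilateral of `e`. -/
def centerAngle (P : CirclePattern X S) (e : S.InteriorDart) : ℝ :=
  angleAt (P.center e) (P.corner e) (P.center (S.flip e)) +
    angleAt (P.center e) (P.center (S.flip e)) (P.corner (S.flip e))

/-- The interior intersection angle, at the point `corner e`, of the circles with centers
`center e` and `center (ι e)`: since circles are orthogonal to their radii, the exterior
intersection angle is the angle between the radii. -/
def interiorIntersectionAngle (P : CirclePattern X S) (e : S.InteriorDart) : ℝ :=
  Real.pi - angleAt (P.corner e) (P.center e) (P.center (S.flip e))

open Classical in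
/-- The pattern has interior intersection angles `θ'` at the interior edges (at both intersection
points of the two circles), and the angles of the quadrilaterals around the center of the circle
of the face `f` add up to `Φ f`: this is the cone angle if `f` is an interior face and the Neumann
boundary condition if `f` is a boundary face. -/
def HasData [Finite D] (P : CirclePattern X S) (θ' : S.InteriorEdge → ℝ) (Φ : S.Face → ℝ) :
    Prop :=
  (∀ e, P.interiorIntersectionAngle e = θ' (S.edge e)) ∧
  ∀ f, ∑ e ∈ Finset.univ.filter (fun e => S.leftFace e = f), P.centerAngle e = Φ f

/-- The closed quadrilateral in the plane that belongs to the edge of `e`. -/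
def quad (P : CirclePattern X S) (e : S.InteriorDart) : Set X :=
  triangle (P.corner e) (P.center e) (P.center (S.flip e)) ∪
    triangle (P.corner (S.flip e)) (P.center e) (P.center (S.flip e))

/-- The gluing of the quadrilaterals:
* `e` and `ι e` have the same quadrilateral;
* if `e` is followed by `σ e` in the boundary of its left face, and both are interior edges, then
  the side from `center e` to `corner (ι e)` is glued isometrically to the side from
  `center (σ e)` to `corner (σ e)`;
* there is only one white vertex for each face. -/
def Glue (P : CirclePattern X S) (p q : Σ e : S.InteriorDart, P.quad e) : Prop :=
  (q.1 = S.flip p.1 ∧ (q.2 : X) = p.2) ∨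
  (q.1.1 = S.σ p.1.1 ∧
    (p.2 : X) ∈ seg (P.center p.1) (P.corner (S.flip p.1)) ∧
    (q.2 : X) ∈ seg (P.center q.1) (P.corner q.1) ∧
    dist (P.center p.1) p.2 = dist (P.center q.1) q.2) ∨
  (S.leftFace p.1 = S.leftFace q.1 ∧ (p.2 : X) = P.center p.1 ∧ (q.2 : X) = P.center q.1)

/-- The cone surface of the pattern, glued from the quadrilaterals. -/
def Surface (P : CirclePattern X S) : Type _ := Quot P.Glue

/-- The map of the quadrilateral of `e` to the surface. -/
def toSurface (P : CirclePattern X S) (e : S.InteriorDart) (x : P.quad e) : P.Surface :=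
  Quot.mk _ ⟨e, x⟩

/-- `P.PathLength p q l`: a finite concatenation of geodesic segments, each of which lies in one of
the quadrilaterals, joins `p` to `q` in the surface and has total length `l`. -/
inductive PathLength (P : CirclePattern X S) : P.Surface → P.Surface → ℝ → Prop
  | refl (p : P.Surface) : PathLength P p p 0
  | step (e : S.InteriorDart) (x y : P.quad e) (q : P.Surface) (l : ℝ) :
      seg (x : X) (y : X) ⊆ P.quad e → PathLength P (P.toSurface e y) q l →
      PathLength P (P.toSurface e x) q (dist (x : X) (y : X) + l)

/-- The intrinsic distance in the cone surface of the pattern. -/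
def surfaceDist (P : CirclePattern X S) (p q : P.Surface) : ℝ :=
  sInf {l | P.PathLength p q l}

/-- There is a similarity with factor `c` from the surface of `P` to the surface of `Q` which
carries the pattern `P` to the pattern `Q`: it carries the quadrilateral of each edge to the
quadrilateral of the same edge by a similarity `A` of the plane that respects all vertices. -/
def SimilarBy (c : ℝ) (P Q : CirclePattern X S) : Prop :=
  ∃ T : P.Surface ≃ Q.Surface,
    (∀ p q, Q.surfaceDist (T p) (T q) = c * P.surfaceDist p q) ∧
    ∀ e : S.InteriorDart, ∃ A : X ≃ X,
      (∀ x y, dist (A x) (A y) = c * dist x y) ∧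
      A (P.center e) = Q.center e ∧ A (P.corner e) = Q.corner e ∧
      A (P.center (S.flip e)) = Q.center (S.flip e) ∧
      A (P.corner (S.flip e)) = Q.corner (S.flip e) ∧
      ∀ x : P.quad e, ∃ h : A x ∈ Q.quad e, T (P.toSurface e x) = Q.toSurface e ⟨A x, h⟩

/-- The patterns agree up to a similarity of the surfaces. -/
def Similar (P Q : CirclePattern X S) : Prop := ∃ c : ℝ, 0 < c ∧ SimilarBy c P Q

/-- The patterns agree up to an isometry of the surfaces. -/
def Isometric (P Q : CirclePattern X S) : Prop := SimilarBy 1 P Q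

end

end CirclePattern

end

/-!
A circle pattern is determined by its radii, and the radii are the solutions of one equation for
each face.  Both geometries are treated at once, with a parameter `κ` that is `0` for the euclidean
and `1` for the hyperbolic plane.  A radius `r` is replaced by the quantity `ρ` that is `r` in the
euclidean and `tanh (r / 2)` in the hyperbolic case; it is the modulus of `dir` from the centre to a
point of the circle.  The planes enter only through `IsConformalModel`: changing the base point of
the coordinate `dir` is, up to a rotation, the map `z ↦ (z - a) / (1 - κ * conj a * z)`.

*Reduction to the radii.*  The quadrilateral of an edge with intersection angle `θ` between circles
of radii `x` and `y` is a kite made of two congruent triangles, and the cotangent of half of its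
angle at the centre of the first circle is `cotHalf κ x y θ`.  Kites exist for all radii
(`IsConformalModel.exists_kite`), so that a pattern with the data `(θ, Φ)` exists if and only if
there are radii with `angleSum κ θ ρ f = Φ f` for all faces `f`
(`CirclePattern.exists_hasData_iff`).  If the radii of two patterns agree up to a factor `c`, which
must be `1` in the hyperbolic plane, then corresponding kites are similar, and the similarities of
the kites fit together (`CirclePattern.similarBy_of_hasRadii`).

*Necessity.*  The two half angles of a kite add up to `θ` in the euclidean and to less than `θ` in
the hyperbolic plane.  Summing the equations over the faces in `F'` gives the inequality
(`CellularSurface.sum_angleSum_lt`).  For a proper subset `F'` some edge leads out of `F'`, because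
faces are connected through interior edges (`CellularSurface.eq_univ_of_flip_mem`).

*Existence.*  No variational principle is used.  The half angle at the centre of the first circle
increases with the radius of the second.  Therefore the minimum of two supersolutions
(`angleSum κ θ ρ f ≤ Φ f` for all `f`) is a supersolution, and the infimum of all supersolutions
is a solution unless some of its coordinates vanish (`exists_zero_of_supersolution`).  If they
vanish exactly on `F'`, there are supersolutions for which the angle sums over `F'` are arbitrarily
close to the sum of `2 * θ` over the edges incident with `F'`, which contradicts the strict
inequality for `F'`.  In the hyperbolic plane large radii provide a supersolution.  In the euclidean
plane a multiple of the radius is added to the prescribed angle, which makes the same argument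
work, and this perturbation is sent to zero (`CellularSurface.exists_angleSum_zero_eq`).

*Uniqueness.*  This is a maximum principle for the quotient of two solutions.  In the hyperbolic
plane, scaling the parameters `ρ` of a kite by a factor greater than `1` decreases its angles, so
the quotient is at most `1`.  In the euclidean plane the angles do not change, and the quotient is
constant by connectedness.
-/

section

open Real Filter Topology ComplexConjugate ModelPlane

/-! ### Edges and faces -/

namespace CellularSurface

variable {D : Type*} (S : CellularSurface D)

@[simp]
theorem flip_flip (e : S.InteriorDart) : S.flip (S.flip e) = e :=
  S.flip.left_inv e

theorem flip_ne (e : S.InteriorDart) : S.flip e ≠ e :=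
  fun h => S.ι_ne e.1 (congrArg Subtype.val h)

@[simp]
theorem edge_flip (e : S.InteriorDart) : S.edge (S.flip e) = S.edge e :=
  Quotient.sound ⟨1, by simp⟩

theorem edge_eq_iff {d e : S.InteriorDart} : S.edge d = S.edge e ↔ d = e ∨ d = S.flip e := by
  constructor
  · intro h
    obtain ⟨i, hi⟩ := (Quotient.exact h : S.flip.SameCycle d e)
    have h2 : S.flip ^ (2 : ℤ) = 1 := by
      ext x
      simp [zpow_ofNat, pow_two]
    rcases Int.even_or_odd' i with ⟨k, rfl | rfl⟩
    · left
      simpa [zpow_mul, h2] using hi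
    · right
      rw [zpow_add, zpow_mul, h2] at hi
      simp only [one_zpow, one_mul, zpow_one] at hi
      rw [← hi, flip_flip]
  · rintro (rfl | rfl)
    · rfl
    · simp

/-- A set of faces that is closed under crossing interior edges contains every face.  The faces
met on the way around a boundary component are connected through interior edges as well, because
the faces around a vertex on the boundary form a fan of triangles without a gap. -/
theorem eq_univ_of_flip_mem [Finite D] (A : Set S.Face) (hA : A.Nonempty)
    (h : ∀ e, S.leftFace e ∈ A → S.leftFace (S.flip e) ∈ A) : A = Set.univ := by
  let c : D → Quotient (Equiv.Perm.SameCycle.setoid S.σ) := fun d => ⟦d⟧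
  let B : D → Prop := fun d => ∃ hd : c d ∉ S.hole, (⟨c d, hd⟩ : S.Face) ∈ A
  have hcσ : ∀ d, c (S.σ d) = c d := fun d =>
    Quotient.sound (Equiv.Perm.SameCycle.symm ⟨1, by simp⟩)
  have hB : ∀ d d', c d = c d' → B d → B d' := by
    rintro d d' hdd ⟨h1, h2⟩
    refine ⟨hdd ▸ h1, ?_⟩
    have : (⟨c d', hdd ▸ h1⟩ : S.Face) = ⟨c d, h1⟩ := Subtype.ext hdd.symm
    rw [this]; exact h2
  have hBι : ∀ d, B d → c (S.ι d) ∉ S.hole → B (S.ι d) := by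
    rintro d ⟨h1, h2⟩ h3
    exact ⟨h3, h ⟨d, h1, h3⟩ h2⟩
  -- the rotation around the vertex between `d` and `σ d`, starting on one side of the hole
  have key : ∀ d, c d ∈ S.hole → B (S.ι d) → B (S.ι (S.σ d)) := by
    intro d hd hBd
    let ν : Equiv.Perm D := S.ι * S.σ⁻¹
    have hhole : c (S.σ d) ∈ S.hole := by rw [hcσ]; exact hd
    have step : ∀ k : ℕ, B ((ν ^ (k + 1)) (S.σ d)) ∨ B (S.ι (S.σ d)) := by
      intro k
      induction k with
      | zero => left; simpa [ν] using hBd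
      | succ k ih =>
        rcases ih with ih | ih
        · have hx : (ν ^ (k + 1 + 1)) (S.σ d) = S.ι (S.σ⁻¹ ((ν ^ (k + 1)) (S.σ d))) := by
            rw [pow_succ' ν (k + 1)]; rfl
          have hB' : B (S.σ⁻¹ ((ν ^ (k + 1)) (S.σ d))) := by
            have h1 := hcσ (S.σ⁻¹ ((ν ^ (k + 1)) (S.σ d)))
            exact hB _ _ ((congrArg c (S.σ.apply_symm_apply _)).symm.trans h1) ih
          by_cases hxe : (ν ^ (k + 1 + 1)) (S.σ d) = S.σ d
          · right
            rw [← hxe, hx, S.ι_ι]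
            exact hB'
          · left
            have hn : c ((ν ^ (k + 1 + 1)) (S.σ d)) ∉ S.hole := by
              intro hmem
              exact hxe (S.hole_vertex (S.σ d) _ ⟨(k + 1 + 1 : ℕ), by rw [zpow_natCast]⟩
                hhole hmem).symm
            rw [hx] at hn ⊢
            exact hBι _ hB' hn
        · exact Or.inr ih
    have hpos : 0 < orderOf ν := orderOf_pos ν
    rcases step (orderOf ν - 1) with h1 | h1
    · rw [Nat.sub_add_cancel hpos, pow_orderOf_eq_one] at h1
      exact absurd hhole h1.1
    · exact h1
  let good : D → Prop := fun d => B d ∨ (c d ∈ S.hole ∧ B (S.ι d))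
  have hgι : ∀ d, good d → good (S.ι d) := by
    rintro d (hd | ⟨_, hd⟩)
    · by_cases hι : c (S.ι d) ∈ S.hole
      · exact Or.inr ⟨hι, by rwa [S.ι_ι]⟩
      · exact Or.inl (hBι d hd hι)
    · exact Or.inl hd
  have hgσ : ∀ d, good d → good (S.σ d) := by
    rintro d (hd | ⟨h1, hd⟩)
    · exact Or.inl (hB _ _ (hcσ d).symm hd)
    · exact Or.inr ⟨by rw [hcσ]; exact h1, key d h1 hd⟩
  have hpow : ∀ g : Equiv.Perm D, (∀ d, good d → good (g d)) →
      ∀ n : ℕ, ∀ d, good d → good ((g ^ n) d) := by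
    intro g hg n
    induction n with
    | zero => intro d hd; simpa using hd
    | succ n ih => intro d hd; rw [pow_succ]; exact ih _ (hg d hd)
  have hgen : ∀ g ∈ Subgroup.closure {S.ι, S.σ}, ∀ d, good d → good (g d) := by
    intro g hg
    induction hg using Subgroup.closure_induction with
    | mem x hx =>
      rcases hx with rfl | rfl
      · exact hgι
      · exact hgσ
    | one => exact fun d hd => hd
    | mul x y _ _ hx hy => exact fun d hd => hx _ (hy _ hd)
    | inv x _ hx =>
      have : x⁻¹ = x ^ (orderOf x - 1) := by
        rw [eq_comm, ← mul_eq_one_iff_eq_inv, ← pow_succ, Nat.sub_add_cancel (orderOf_pos x),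
          pow_orderOf_eq_one]
      rw [this]
      exact hpow x hx _
  obtain ⟨⟨f₀, hf₀⟩, hf₀A⟩ := hA
  refine Set.eq_univ_of_forall ?_
  rintro ⟨f, hf⟩
  induction f₀ using Quotient.inductionOn with | _ d₀ => ?_
  induction f using Quotient.inductionOn with | _ d => ?_
  obtain ⟨⟨g, hg⟩, hgd⟩ := S.connected.exists_smul_eq d₀ d
  have hd : good d := by
    have := hgen g hg d₀ (Or.inl ⟨hf₀, hf₀A⟩)
    rwa [show g d₀ = d from hgd] at this
  rcases hd with ⟨_, h2⟩ | ⟨h1, _⟩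
  · exact h2
  · exact absurd h1 hf

/-- The set of faces is nonempty, because no edge has holes on both sides. -/
theorem nonempty_face [Nonempty D] : Nonempty S.Face := by
  obtain ⟨d⟩ := ‹Nonempty D›
  by_cases h : (⟦d⟧ : Quotient (Equiv.Perm.SameCycle.setoid S.σ)) ∈ S.hole
  · exact ⟨⟨⟦S.ι d⟧, S.hole_edge d h⟩⟩
  · exact ⟨⟨⟦d⟧, h⟩⟩

open Classical in
/-- The sum of the angles over the faces in `F'`, collected by oriented edges: an interior
edge inside `F'` contributes through both of its orientations. -/
theorem sum_sum_leftFace [Finite D] (F' : Finset S.Face) (ψ : S.InteriorDart → ℝ) :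
    ∑ f ∈ F', ∑ e ∈ Finset.univ.filter (fun e => S.leftFace e = f), 2 * ψ e =
      ∑ e ∈ Finset.univ.filter (fun e => S.leftFace e ∈ F'),
        if S.leftFace (S.flip e) ∈ F' then ψ e + ψ (S.flip e) else 2 * ψ e := by
  have h1 : ∑ f ∈ F', ∑ e ∈ Finset.univ.filter (fun e => S.leftFace e = f), 2 * ψ e =
      ∑ e ∈ Finset.univ.filter (fun e => S.leftFace e ∈ F'), 2 * ψ e := by
    simp only [Finset.sum_filter]
    rw [Finset.sum_comm]
    refine Finset.sum_congr rfl fun e _ => ?_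
    rw [Finset.sum_ite_eq]
  have h2 : ∑ e : S.InteriorDart, (if S.leftFace e ∈ F' ∧ S.leftFace (S.flip e) ∈ F'
      then ψ (S.flip e) else 0) = ∑ e : S.InteriorDart,
        (if S.leftFace e ∈ F' ∧ S.leftFace (S.flip e) ∈ F' then ψ e else 0) := by
    rw [← Equiv.sum_comp S.flip]
    refine Finset.sum_congr rfl fun e _ => ?_
    simp only [flip_flip, and_comm]
  rw [h1, Finset.sum_filter, Finset.sum_filter]
  refine add_right_cancel (b := ∑ e : S.InteriorDart, (if S.leftFace e ∈ F' ∧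
    S.leftFace (S.flip e) ∈ F' then ψ (S.flip e) else 0)) ?_
  nth_rewrite 2 [h2]
  rw [← Finset.sum_add_distrib, ← Finset.sum_add_distrib]
  refine Finset.sum_congr rfl fun e _ => ?_
  by_cases ha : S.leftFace e ∈ F' <;> by_cases hb : S.leftFace (S.flip e) ∈ F' <;>
    simp [ha, hb]
  ring

open Classical in
theorem sum_incidentEdges [Finite D] (F' : Finset S.Face) (θ : S.InteriorEdge → ℝ) :
    ∑ e ∈ S.incidentEdges F', 2 * θ e =
      ∑ e ∈ Finset.univ.filter (fun e => S.leftFace e ∈ F'),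
        if S.leftFace (S.flip e) ∈ F' then θ (S.edge e) else 2 * θ (S.edge e) := by
  unfold incidentEdges
  rw [Finset.sum_filter, Finset.sum_filter,
    ← Finset.sum_fiberwise (s := Finset.univ) (g := S.edge)]
  refine Finset.sum_congr rfl fun e _ => ?_
  induction e using Quotient.inductionOn with | _ d => ?_
  change _ = ∑ i ∈ Finset.univ.filter (fun i => S.edge i = S.edge d), _
  have hf : Finset.univ.filter (fun i => S.edge i = S.edge d) = {d, S.flip d} := by
    ext i
    simp [edge_eq_iff]
  rw [hf, Finset.sum_pair (S.flip_ne d).symm]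
  have hex : (∃ d' : S.InteriorDart, S.edge d' = S.edge d ∧ S.leftFace d' ∈ F') ↔
      (S.leftFace d ∈ F' ∨ S.leftFace (S.flip d) ∈ F') := by
    simp only [edge_eq_iff]
    constructor
    · rintro ⟨d', rfl | rfl, h⟩
      · exact Or.inl h
      · exact Or.inr h
    · rintro (h | h)
      · exact ⟨d, Or.inl rfl, h⟩
      · exact ⟨S.flip d, Or.inr rfl, h⟩
  change (if ∃ d' : S.InteriorDart, S.edge d' = S.edge d ∧ S.leftFace d' ∈ F'
    then 2 * θ (S.edge d) else 0) = _
  simp only [hex, flip_flip, edge_flip]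
  by_cases ha : S.leftFace d ∈ F' <;> by_cases hb : S.leftFace (S.flip d) ∈ F' <;>
    simp [ha, hb]
  ring

end CellularSurface

/-! ### The angle of a kite at a white vertex -/

/-- The inverse cotangent with values in `(0, π)`. -/
noncomputable def arccot (u : ℝ) : ℝ := π / 2 - arctan u

theorem arccot_pos (u : ℝ) : 0 < arccot u := by
  have := arctan_lt_pi_div_two u
  unfold arccot; linarith

theorem arccot_lt_pi (u : ℝ) : arccot u < π := by
  have := neg_pi_div_two_lt_arctan u
  unfold arccot; linarith

theorem arccot_strictAnti : StrictAnti arccot := fun u v h => by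
  have := arctan_strictMono h
  unfold arccot; linarith

theorem continuous_arccot : Continuous arccot := continuous_const.sub continuous_arctan

theorem arccot_cos_div_sin {α : ℝ} (h0 : 0 < α) (h1 : α < π) : arccot (cos α / sin α) = α := by
  have : arctan (cos α / sin α) = π / 2 - α := by
    apply arctan_eq_of_tan_eq
    · rw [tan_eq_sin_div_cos, sin_pi_div_two_sub, cos_pi_div_two_sub]
    · constructor <;> linarith
  unfold arccot; linarith

theorem cos_arccot_div_sin_arccot (u : ℝ) : cos (arccot u) / sin (arccot u) = u := by
  unfold arccot
  rw [cos_pi_div_two_sub, sin_pi_div_two_sub, ← tan_eq_sin_div_cos, tan_arctan]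

/-- The inverse cotangent is `1`-Lipschitz. -/
theorem arccot_sub_le {u v t : ℝ} (ht : 0 ≤ t) (h : u ≤ v + t) : arccot v - t ≤ arccot u := by
  have h1 : arctan u ≤ arctan (v + t) := arctan_mono h
  have h2 : ‖arctan (v + t) - arctan v‖ ≤ 1 * ‖v + t - v‖ := by
    refine Convex.norm_image_sub_le_of_norm_hasDerivWithin_le (s := Set.univ)
      (f' := fun x => 1 / (1 + x ^ 2)) (fun x _ => (hasDerivAt_arctan x).hasDerivWithinAt)
      (fun x _ => ?_) convex_univ (Set.mem_univ _) (Set.mem_univ _)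
    rw [norm_of_nonneg (by positivity), div_le_one (by positivity)]
    nlinarith [sq_nonneg x]
  rw [add_sub_cancel_left, one_mul, norm_of_nonneg ht] at h2
  have h3 := (le_abs_self _).trans h2
  unfold arccot; linarith

/-- The cotangent of the angle of a triangle with adjacent side `x`, opposite side `y` and
enclosed angle `π - θ`.  For `κ = 0` the triangle is euclidean.  For `κ = 1` it is hyperbolic, and a
side of length `l` is measured by `tanh (l / 2)`. -/
noncomputable def cotHalf (κ x y θ : ℝ) : ℝ :=
  (x * (1 + κ * y ^ 2) + y * (1 + κ * x ^ 2) * cos θ) / (y * (1 - κ * x ^ 2) * sin θ)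

/-- Half of the angle, at its white vertex with radius `x`, of the kite of two circles with radii
`x` and `y` and interior intersection angle `θ`. -/
noncomputable def halfAngle (κ x y θ : ℝ) : ℝ := arccot (cotHalf κ x y θ)

theorem halfAngle_pos (κ x y θ : ℝ) : 0 < halfAngle κ x y θ := arccot_pos _

theorem cotHalf_zero (x : ℝ) {y : ℝ} (hy : 0 < y) (θ : ℝ) :
    cotHalf 0 x y θ = (x / y + cos θ) / sin θ := by
  unfold cotHalf
  field_simp
  ring_nf

/-- In a euclidean triangle the angles add up to `π`. -/
theorem halfAngle_zero_add {x y θ : ℝ} (hx : 0 < x) (hy : 0 < y) (h0 : 0 < θ) (h1 : θ < π) :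
    halfAngle 0 x y θ + halfAngle 0 y x θ = θ := by
  have hs : 0 < sin θ := sin_pos_of_pos_of_lt_pi h0 h1
  have hu := cotHalf_zero x hy θ
  set u := cotHalf 0 x y θ with hudef
  have hα0 := arccot_pos u
  have hαπ := arccot_lt_pi u
  have hlt : arccot u < θ := by
    rw [← arccot_cos_div_sin h0 h1]
    apply arccot_strictAnti
    rw [hu]
    gcongr
    have := div_pos hx hy
    linarith
  have hsα : 0 < sin (arccot u) := sin_pos_of_pos_of_lt_pi hα0 hαπ
  have hcot : cos (arccot u) = u * sin (arccot u) := by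
    rw [← div_eq_iff hsα.ne', cos_arccot_div_sin_arccot]
  have h2 : cotHalf 0 y x θ = cos (θ - arccot u) / sin (θ - arccot u) := by
    have hs' : 0 < sin (θ - arccot u) := sin_pos_of_pos_of_lt_pi (by linarith) (by linarith)
    rw [cotHalf_zero y hx, div_eq_div_iff hs.ne' hs'.ne', sin_sub, cos_sub, hcot]
    generalize sin (arccot u) = s
    rw [hu]
    field_simp
    linear_combination (-x * y * s) * sin_sq_add_cos_sq θ
  unfold halfAngle
  rw [h2, arccot_cos_div_sin (by linarith) (by linarith)]
  change arccot u + _ = _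
  ring

/-- Positive because it is the square of the third side. -/
theorem add_sq_cos_pos {x y θ : ℝ} (hx : 0 < x) (hy : 0 < y) (h0 : 0 < θ) (h1 : θ < π) :
    0 < x ^ 2 + y ^ 2 + 2 * x * y * cos θ := by
  have : -1 < cos θ := by
    rw [← cos_pi]
    exact cos_lt_cos_of_nonneg_of_le_pi h0.le le_rfl h1
  nlinarith [sq_nonneg (x - y), mul_pos hx hy]

theorem cotHalf_sub_zero {κ x y θ : ℝ} (hy : 0 < y) (hκx : κ * x ^ 2 < 1) (hs : 0 < sin θ) :
    cotHalf κ x y θ - cotHalf 0 x y θ =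
      κ * x * (x ^ 2 + y ^ 2 + 2 * x * y * cos θ) / (y * (1 - κ * x ^ 2) * sin θ) := by
  have : 1 - κ * x ^ 2 ≠ 0 := by linarith
  rw [cotHalf_zero x hy]
  unfold cotHalf
  rw [div_sub_div _ _ (by positivity) hs.ne', div_eq_div_iff (by positivity) (by positivity)]
  field_simp
  ring

theorem halfAngle_le_zero {κ x y θ : ℝ} (hκ : 0 ≤ κ) (hx : 0 < x) (hy : 0 < y)
    (hκx : κ * x ^ 2 < 1) (h0 : 0 < θ) (h1 : θ < π) :
    halfAngle κ x y θ ≤ halfAngle 0 x y θ := by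
  have hs : 0 < sin θ := sin_pos_of_pos_of_lt_pi h0 h1
  apply arccot_strictAnti.antitone
  rw [← sub_nonneg, cotHalf_sub_zero hy hκx hs]
  have := add_sq_cos_pos hx hy h0 h1
  have : 0 < 1 - κ * x ^ 2 := by linarith
  positivity

/-- The angles of a hyperbolic triangle are smaller than those of a euclidean one. -/
theorem halfAngle_lt_zero {κ x y θ : ℝ} (hκ : 0 < κ) (hx : 0 < x) (hy : 0 < y)
    (hκx : κ * x ^ 2 < 1) (h0 : 0 < θ) (h1 : θ < π) :
    halfAngle κ x y θ < halfAngle 0 x y θ := by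
  have hs : 0 < sin θ := sin_pos_of_pos_of_lt_pi h0 h1
  apply arccot_strictAnti
  rw [← sub_pos, cotHalf_sub_zero hy hκx hs]
  have := add_sq_cos_pos hx hy h0 h1
  have : 0 < 1 - κ * x ^ 2 := by linarith
  positivity

theorem cotHalf_lt_of_lt_right {κ x y z θ : ℝ} (hκ : 0 ≤ κ) (hx : 0 < x) (hy : 0 < y)
    (hyz : y < z) (hκx : κ * x ^ 2 < 1) (hκz : κ * z ^ 2 < 1) (h0 : 0 < θ) (h1 : θ < π) :
    cotHalf κ x z θ < cotHalf κ x y θ := by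
  have hs : 0 < sin θ := sin_pos_of_pos_of_lt_pi h0 h1
  have hx1 : 0 < 1 - κ * x ^ 2 := by linarith
  have hz : 0 < z := hy.trans hyz
  have hyz1 : 0 < 1 - κ * (y * z) := by
    have : κ * (y * z) ≤ κ * z ^ 2 := by
      apply mul_le_mul_of_nonneg_left _ hκ
      nlinarith
    linarith
  rw [← sub_pos]
  have : cotHalf κ x y θ - cotHalf κ x z θ =
      x * (z - y) * (1 - κ * (y * z)) / (y * z * (1 - κ * x ^ 2) * sin θ) := by
    unfold cotHalf
    field_simp
    ring
  rw [this]
  have : 0 < z - y := sub_pos.2 hyz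
  positivity

theorem halfAngle_mono_right {κ x y z θ : ℝ} (hκ : 0 ≤ κ) (hx : 0 < x) (hy : 0 < y)
    (hyz : y ≤ z) (hκx : κ * x ^ 2 < 1) (hκz : κ * z ^ 2 < 1) (h0 : 0 < θ) (h1 : θ < π) :
    halfAngle κ x y θ ≤ halfAngle κ x z θ := by
  rcases hyz.eq_or_lt with rfl | h
  · exact le_rfl
  · exact (arccot_strictAnti (cotHalf_lt_of_lt_right hκ hx hy h hκx hκz h0 h1)).le

/-- Because of this identity, scaling both radii with the same factor `c > 1` makes the angles of a
hyperbolic kite smaller. -/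
theorem cotHalf_mul_sub {κ c x y θ : ℝ} (hc : 0 < c) (hy : 0 < y)
    (hκx : κ * x ^ 2 < 1) (hκcx : κ * (c * x) ^ 2 < 1) (hs : 0 < sin θ) :
    cotHalf κ (c * x) (c * y) θ - cotHalf κ x y θ =
      κ * (c ^ 2 - 1) * x * (x ^ 2 + y ^ 2 + 2 * x * y * cos θ) /
        (y * (1 - κ * x ^ 2) * (1 - κ * (c * x) ^ 2) * sin θ) := by
  have h1 : 1 - κ * x ^ 2 ≠ 0 := by linarith
  have h2 : 1 - κ * (c * x) ^ 2 ≠ 0 := by linarith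
  unfold cotHalf
  rw [div_sub_div _ _ (by positivity) (by positivity),
    div_eq_div_iff (by positivity) (by positivity)]
  ring

theorem halfAngle_zero_mul {c : ℝ} (hc : 0 < c) (x y θ : ℝ) :
    halfAngle 0 (c * x) (c * y) θ = halfAngle 0 x y θ := by
  unfold halfAngle cotHalf
  congr 1
  rw [show c * x * (1 + 0 * (c * y) ^ 2) + c * y * (1 + 0 * (c * x) ^ 2) * cos θ =
    c * (x * (1 + 0 * y ^ 2) + y * (1 + 0 * x ^ 2) * cos θ) by ring,
    show c * y * (1 - 0 * (c * x) ^ 2) * sin θ = c * (y * (1 - 0 * x ^ 2) * sin θ) by ring,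
    mul_div_mul_left _ _ hc.ne']

theorem halfAngle_mul_le {κ c x y θ : ℝ} (hκ : 0 ≤ κ) (hc : 1 ≤ c) (hx : 0 < x) (hy : 0 < y)
    (hκcx : κ * (c * x) ^ 2 < 1) (h0 : 0 < θ) (h1 : θ < π) :
    halfAngle κ (c * x) (c * y) θ ≤ halfAngle κ x y θ := by
  have hs : 0 < sin θ := sin_pos_of_pos_of_lt_pi h0 h1
  have hκx : κ * x ^ 2 < 1 := by
    refine lt_of_le_of_lt (mul_le_mul_of_nonneg_left ?_ hκ) hκcx
    gcongr
    nlinarith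
  apply arccot_strictAnti.antitone
  rw [← sub_nonneg, cotHalf_mul_sub (by linarith) hy hκx hκcx hs]
  have := add_sq_cos_pos hx hy h0 h1
  have : 0 < 1 - κ * x ^ 2 := by linarith
  have : 0 < 1 - κ * (c * x) ^ 2 := by linarith
  have : 0 ≤ c ^ 2 - 1 := by nlinarith
  positivity

theorem halfAngle_mul_lt {κ c x y θ : ℝ} (hκ : 0 < κ) (hc : 1 < c) (hx : 0 < x) (hy : 0 < y)
    (hκcx : κ * (c * x) ^ 2 < 1) (h0 : 0 < θ) (h1 : θ < π) :
    halfAngle κ (c * x) (c * y) θ < halfAngle κ x y θ := by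
  have hs : 0 < sin θ := sin_pos_of_pos_of_lt_pi h0 h1
  have hκx : κ * x ^ 2 < 1 := by
    refine lt_of_le_of_lt (mul_le_mul_of_nonneg_left ?_ hκ.le) hκcx
    gcongr
    nlinarith
  apply arccot_strictAnti
  rw [← sub_pos, cotHalf_mul_sub (by linarith) hy hκx hκcx hs]
  have := add_sq_cos_pos hx hy h0 h1
  have : 0 < 1 - κ * x ^ 2 := by linarith
  have : 0 < 1 - κ * (c * x) ^ 2 := by linarith
  have : 0 < c ^ 2 - 1 := by nlinarith
  positivity

/-- The angle of a euclidean kite at the centre of a small circle is close to its supremum. -/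
theorem le_halfAngle_zero {x y θ : ℝ} (hx : 0 < x) (hy : 0 < y) (h0 : 0 < θ) (h1 : θ < π) :
    θ - x / y / sin θ ≤ halfAngle 0 x y θ := by
  have hs : 0 < sin θ := sin_pos_of_pos_of_lt_pi h0 h1
  have := arccot_sub_le (u := cotHalf 0 x y θ) (v := cos θ / sin θ) (t := x / y / sin θ)
    (by positivity) (by rw [cotHalf_zero x hy]; apply le_of_eq; ring)
  rwa [arccot_cos_div_sin h0 h1] at this

/-- In terms of `a ρ = ρ / (1 - ρ ^ 2)`, which is half of `sinh` of the length, the angle of a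
hyperbolic kite is close to the angle of the euclidean kite with radii `a x` and `a y` when the
radius `x` is small, whatever `y` is. -/
theorem le_halfAngle_one {x y θ : ℝ} (hx : 0 < x) (hx1 : x ≤ 1 / 2) (hy : 0 < y) (hy1 : y < 1)
    (h0 : 0 < θ) (h1 : θ < π) :
    halfAngle 0 (x / (1 - x ^ 2)) (y / (1 - y ^ 2)) θ - 8 * x / sin θ ≤ halfAngle 1 x y θ := by
  have hs : 0 < sin θ := sin_pos_of_pos_of_lt_pi h0 h1
  have hx2 : 0 < 1 - x ^ 2 := by nlinarith
  have hy2 : 0 < 1 - y ^ 2 := by nlinarith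
  apply arccot_sub_le (by positivity)
  rw [cotHalf_zero _ (by positivity), ← sub_le_iff_le_add']
  have : cotHalf 1 x y θ - (x / (1 - x ^ 2) / (y / (1 - y ^ 2)) + cos θ) / sin θ =
      (2 * x * y + 2 * x ^ 2 * cos θ) / (1 - x ^ 2) / sin θ := by
    unfold cotHalf
    simp only [one_mul]
    field_simp
    ring
  rw [this]
  gcongr
  rw [div_le_iff₀ hx2]
  have := cos_le_one θ
  have : x ^ 2 * cos θ ≤ x ^ 2 * 1 := by gcongr
  nlinarith [mul_pos hx hy]

theorem continuousAt_cotHalf {X : Type*} [TopologicalSpace X] {κ θ : ℝ} {f g : X → ℝ} {r : X}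
    (hf : ContinuousAt f r) (hg : ContinuousAt g r) (hx : κ * f r ^ 2 < 1) (hy : 0 < g r)
    (hs : 0 < sin θ) : ContinuousAt (fun r => cotHalf κ (f r) (g r) θ) r := by
  unfold cotHalf
  refine ContinuousAt.div (by fun_prop) (by fun_prop) ?_
  have : 0 < 1 - κ * f r ^ 2 := by linarith
  positivity

/-- In a hyperbolic kite the angle at a white vertex decreases with the radius at this vertex. -/
theorem cotHalf_one_mono_left {x₁ x₂ y θ : ℝ} (hx₁ : 0 < x₁) (h : x₁ < x₂) (hx₂ : x₂ < 1)
    (hy : 0 < y) (h0 : 0 < θ) (h1 : θ < π) :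
    cotHalf 1 x₁ y θ < cotHalf 1 x₂ y θ := by
  have hs : 0 < sin θ := sin_pos_of_pos_of_lt_pi h0 h1
  have ha : 0 < 1 - 1 * x₁ ^ 2 := by nlinarith
  have hb : 0 < 1 - 1 * x₂ ^ 2 := by nlinarith
  rw [← sub_pos]
  have : cotHalf 1 x₂ y θ - cotHalf 1 x₁ y θ =
      (x₂ - x₁) * ((1 + y ^ 2) * (1 + x₁ * x₂) + 2 * y * (x₁ + x₂) * cos θ) /
        (y * (1 - 1 * x₁ ^ 2) * (1 - 1 * x₂ ^ 2) * sin θ) := by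
    unfold cotHalf
    rw [div_sub_div _ _ (by positivity) (by positivity),
      div_eq_div_iff (by positivity) (by positivity)]
    ring
  rw [this]
  have hx : 0 < x₂ - x₁ := sub_pos.2 h
  have hcos : -1 < cos θ := by
    rw [← cos_pi]
    exact cos_lt_cos_of_nonneg_of_le_pi h0.le le_rfl h1
  have h2 : 0 < (1 + y ^ 2) * (1 + x₁ * x₂) + 2 * y * (x₁ + x₂) * cos θ := by
    have h3 : 0 < 2 * y * (x₁ + x₂) := by nlinarith
    have h4 : 2 * y * (x₁ + x₂) ≤ (1 + y ^ 2) * (1 + x₁ * x₂) := by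
      apply mul_le_mul _ _ (by linarith) (by positivity)
      · nlinarith [sq_nonneg (y - 1)]
      · nlinarith
    nlinarith
  positivity

theorem tendsto_halfAngle_one {θ : ℝ} (h0 : 0 < θ) (h1 : θ < π) :
    Tendsto (fun R => halfAngle 1 R R θ) (𝓝[<] 1) (𝓝 0) := by
  have hs : 0 < sin θ := sin_pos_of_pos_of_lt_pi h0 h1
  have hcos : -1 < cos θ := by
    rw [← cos_pi]
    exact cos_lt_cos_of_nonneg_of_le_pi h0.le le_rfl h1
  have hA : Tendsto arccot atTop (𝓝 0) := by
    have := (tendsto_const_nhds (x := π / 2)).sub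
      (tendsto_arctan_atTop.mono_right nhdsWithin_le_nhds)
    rw [sub_self] at this
    exact this
  refine hA.comp ?_
  have h2 : Tendsto (fun R : ℝ => (1 + R ^ 2) * (1 + cos θ) / sin θ * (1 - R ^ 2)⁻¹) (𝓝[<] 1)
      atTop := by
    refine Tendsto.pos_mul_atTop (C := (1 + 1 ^ 2) * (1 + cos θ) / sin θ) ?_ ?_ ?_
    · have : 0 < 1 + cos θ := by linarith
      positivity
    · refine Tendsto.mono_left (ContinuousAt.tendsto (f := fun R : ℝ =>
        (1 + R ^ 2) * (1 + cos θ) / sin θ) (x := 1) (by fun_prop)) nhdsWithin_le_nhds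
    · refine tendsto_inv_nhdsGT_zero.comp ?_
      rw [tendsto_nhdsWithin_iff]
      constructor
      · refine Tendsto.mono_left ?_ nhdsWithin_le_nhds
        have : ContinuousAt (fun R : ℝ => 1 - R ^ 2) 1 := by fun_prop
        simpa using this.tendsto
      · filter_upwards [Ioo_mem_nhdsLT (show (0 : ℝ) < 1 by norm_num)] with R hR
        have := hR.1
        have := hR.2
        simp only [Set.mem_Ioi]
        nlinarith
  refine h2.congr' ?_
  filter_upwards [Ioo_mem_nhdsLT (show (0 : ℝ) < 1 by norm_num)] with R hR
  have hR0 := hR.1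
  have : 0 < 1 - R ^ 2 := by nlinarith [hR.2]
  unfold cotHalf
  field_simp

/-! ### A discrete Perron method -/

theorem exists_pos_forall_lt {ι : Type*} [Finite ι] (A : Set ι) (g : ι → ℝ)
    (h : ∀ i ∈ A, 0 < g i) : ∃ c : ℝ, 0 < c ∧ ∀ i ∈ A, c < g i := by
  have h1 : ∀ᶠ c in 𝓝[>] (0 : ℝ), ∀ i, i ∈ A → c < g i := by
    rw [eventually_all]
    intro i
    by_cases hi : i ∈ A
    · filter_upwards [Ioo_mem_nhdsGT (h i hi)] with c hc _
      exact hc.2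
    · exact Eventually.of_forall fun c hc => absurd hc hi
  obtain ⟨c, hc, hc'⟩ := (h1.and self_mem_nhdsWithin).exists
  exact ⟨c, hc', hc⟩

/-- Call `r` a supersolution if `K r ≤ 0`.  When `K r f` is increasing in the other coordinates
`r g`, the minimum of two supersolutions is a supersolution.  The infimum of all supersolutions
below a given one is then a zero of `K`, unless it touches the boundary of the positive orthant,
which the last hypothesis forbids. -/
theorem exists_zero_of_supersolution {ι : Type*} [Fintype ι] (K : (ι → ℝ) → ι → ℝ) (R : ι → ℝ)
    (hR0 : ∀ i, 0 < R i)
    (hcont : ∀ r, (∀ i, 0 < r i) → r ≤ R → ∀ i, ContinuousAt (fun r => K r i) r)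
    (hmono : ∀ i r s, (∀ j, 0 < r j) → r ≤ s → s ≤ R → r i = s i → K r i ≤ K s i)
    (hR : K R ≤ 0)
    (hbdry : ∀ A : Finset ι, A.Nonempty → ∀ c : ℝ, 0 < c → ∃ η : ℝ, 0 < η ∧
      ∀ r, (∀ i, 0 < r i) → r ≤ R → (∀ i ∈ A, r i < η) → (∀ i ∉ A, c ≤ r i) →
        ∃ i ∈ A, 0 < K r i) :
    ∃ r, (∀ i, 0 < r i) ∧ r ≤ R ∧ ∀ i, K r i = 0 := by
  classical
  let Z : Set (ι → ℝ) := {r | (∀ i, 0 < r i) ∧ r ≤ R ∧ K r ≤ 0}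
  have hRZ : R ∈ Z := ⟨hR0, le_rfl, hR⟩
  have hinf : ∀ r ∈ Z, ∀ s ∈ Z, r ⊓ s ∈ Z := by
    rintro r ⟨hr0, hrR, hr⟩ s ⟨hs0, hsR, hs⟩
    have h0 : ∀ i, 0 < (r ⊓ s) i := fun i => lt_min (hr0 i) (hs0 i)
    refine ⟨h0, inf_le_left.trans hrR, fun i => ?_⟩
    rcases le_total (r i) (s i) with h | h
    · exact (hmono i _ r h0 inf_le_left hrR (by simp [h])).trans (hr i)
    · exact (hmono i _ s h0 inf_le_right hsR (by simp [h])).trans (hs i)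
  let m : ι → ℝ := fun i => sInf ((fun r : ι → ℝ => r i) '' Z)
  have hbdd : ∀ i, BddBelow ((fun r : ι → ℝ => r i) '' Z) := fun i =>
    ⟨0, by rintro _ ⟨r, hr, rfl⟩; exact (hr.1 i).le⟩
  have hne : ∀ i, ((fun r : ι → ℝ => r i) '' Z).Nonempty := fun i => ⟨_, R, hRZ, rfl⟩
  have hmle : ∀ r ∈ Z, m ≤ r := fun r hr i => csInf_le (hbdd i) ⟨r, hr, rfl⟩
  have hm0 : ∀ i, 0 ≤ m i := fun i =>
    le_csInf (hne i) (by rintro _ ⟨r, hr, rfl⟩; exact (hr.1 i).le)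
  have happrox : ∀ η : ℝ, 0 < η → ∃ r ∈ Z, ∀ i, r i < m i + η := by
    intro η hη
    have : ∀ A : Finset ι, ∃ r ∈ Z, ∀ i ∈ A, r i < m i + η := by
      intro A
      induction A using Finset.induction_on with
      | empty => exact ⟨R, hRZ, by simp⟩
      | insert a A _ ih =>
        obtain ⟨r, hrZ, hr⟩ := ih
        obtain ⟨_, ⟨s, hsZ, rfl⟩, hs⟩ := exists_lt_of_csInf_lt (hne a)
          (show m a < m a + η by linarith)
        refine ⟨r ⊓ s, hinf r hrZ s hsZ, fun i hi => ?_⟩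
        rcases Finset.mem_insert.1 hi with rfl | hi
        · exact lt_of_le_of_lt inf_le_right hs
        · exact lt_of_le_of_lt inf_le_left (hr i hi)
    obtain ⟨r, hrZ, hr⟩ := this Finset.univ
    exact ⟨r, hrZ, fun i => hr i (Finset.mem_univ i)⟩
  have hmpos : ∀ i, 0 < m i := by
    by_contra hcon
    push Not at hcon
    obtain ⟨i₀, hi₀⟩ := hcon
    let A : Finset ι := Finset.univ.filter fun i => m i ≤ 0
    obtain ⟨c, hc, hcm⟩ := exists_pos_forall_lt {i | i ∉ A} m (fun i hi => by
      simpa [A] using hi)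
    obtain ⟨η, hη, h⟩ := hbdry A ⟨i₀, by simpa [A] using hi₀⟩ c hc
    obtain ⟨r, hrZ, hr⟩ := happrox η hη
    obtain ⟨i, _, hi⟩ := h r hrZ.1 hrZ.2.1 (fun i hi => by
      have : m i ≤ 0 := by simpa [A] using hi
      linarith [hr i]) (fun i hi => (hcm i hi).le.trans (hmle r hrZ i))
    exact absurd (hrZ.2.2 i) (not_le.2 hi)
  have hmR : m ≤ R := hmle R hRZ
  have hKm : K m ≤ 0 := by
    intro i
    by_contra hcon
    have hcon : 0 < K m i := not_le.1 hcon
    have := (hcont m hmpos hmR i).eventually (lt_mem_nhds hcon)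
    obtain ⟨η, hη, h⟩ := Metric.eventually_nhds_iff.1 this
    obtain ⟨r, hrZ, hr⟩ := happrox η hη
    have hd : dist r m < η := (dist_pi_lt_iff hη).2 fun j => by
      have h1 := hr j
      have h2 := hmle r hrZ j
      rw [Real.dist_eq, abs_of_nonneg (by linarith)]
      linarith
    exact absurd (hrZ.2.2 i) (not_le.2 (h hd))
  refine ⟨m, hmpos, hmR, fun i => le_antisymm (hKm i) ?_⟩
  -- a strict inequality would allow to decrease the coordinate `i`
  by_contra hcon
  have hcon : K m i < 0 := not_le.1 hcon
  have hup : ContinuousAt (fun t : ℝ => Function.update m i t) (m i) := by fun_prop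
  have hup' : Tendsto (fun t : ℝ => Function.update m i t) (𝓝 (m i)) (𝓝 m) := by
    have := hup.tendsto
    rwa [Function.update_eq_self] at this
  have h1 : ∀ᶠ t in 𝓝 (m i), K (Function.update m i t) i < 0 :=
    hup'.eventually ((hcont m hmpos hmR i).eventually (gt_mem_nhds hcon))
  have h2 : ∀ᶠ t in 𝓝[<] (m i), K (Function.update m i t) i < 0 :=
    h1.filter_mono nhdsWithin_le_nhds
  obtain ⟨t, ht, ht'⟩ := (h2.and (Ioo_mem_nhdsLT (hmpos i))).exists
  have hle : Function.update m i t ≤ m := by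
    intro j
    by_cases hj : j = i
    · subst hj; simpa using ht'.2.le
    · simp [hj]
  have hpos : ∀ j, 0 < Function.update m i t j := by
    intro j
    by_cases hj : j = i
    · subst hj; simpa using ht'.1
    · simpa [hj] using hmpos j
  have hZ : Function.update m i t ∈ Z := by
    refine ⟨hpos, hle.trans hmR, fun j => ?_⟩
    by_cases hj : j = i
    · subst hj; exact ht.le
    · exact (hmono j _ m hpos hle hmR (by simp [hj])).trans (hKm j)
  have := hmle _ hZ i
  rw [Function.update_self] at this
  exact absurd this (not_le.2 ht'.2)

/-! ### The equations for the radii -/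

namespace CellularSurface

variable {D : Type*} [Finite D] (S : CellularSurface D)

open Classical in
/-- The sum of the angles of the kites around the white vertex of `f`, as a function of the
radii `ρ` of the circles. -/
noncomputable def angleSum (κ : ℝ) (θ : S.InteriorEdge → ℝ) (ρ : S.Face → ℝ) (f : S.Face) : ℝ :=
  ∑ e ∈ Finset.univ.filter (fun e => S.leftFace e = f),
    2 * halfAngle κ (ρ (S.leftFace e)) (ρ (S.leftFace (S.flip e))) (θ (S.edge e))

variable {S} {θ : S.InteriorEdge → ℝ}

open Classical in
theorem sum_angleSum (κ : ℝ) (θ : S.InteriorEdge → ℝ) (ρ : S.Face → ℝ) (F' : Finset S.Face) :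
    ∑ f ∈ F', S.angleSum κ θ ρ f = ∑ e ∈ Finset.univ.filter (fun e => S.leftFace e ∈ F'),
      if S.leftFace (S.flip e) ∈ F' then
        halfAngle κ (ρ (S.leftFace e)) (ρ (S.leftFace (S.flip e))) (θ (S.edge e)) +
          halfAngle κ (ρ (S.leftFace (S.flip e))) (ρ (S.leftFace e)) (θ (S.edge e))
      else 2 * halfAngle κ (ρ (S.leftFace e)) (ρ (S.leftFace (S.flip e))) (θ (S.edge e)) := by
  unfold angleSum
  rw [S.sum_sum_leftFace F' fun e =>
    halfAngle κ (ρ (S.leftFace e)) (ρ (S.leftFace (S.flip e))) (θ (S.edge e))]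
  simp only [flip_flip, edge_flip]

theorem angleSum_mono (hθ : ∀ e, θ e ∈ Set.Ioo 0 π) {κ : ℝ} (hκ : 0 ≤ κ) {ρ ρ' : S.Face → ℝ}
    (hρ : ∀ f, 0 < ρ f) (hle : ρ ≤ ρ') (hρ' : ∀ f, κ * ρ' f ^ 2 < 1) {f : S.Face}
    (hf : ρ f = ρ' f) : S.angleSum κ θ ρ f ≤ S.angleSum κ θ ρ' f := by
  classical
  unfold angleSum
  refine Finset.sum_le_sum fun e he => ?_
  have he : S.leftFace e = f := by simpa using he
  rw [he, ← hf]
  gcongr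
  exact halfAngle_mono_right hκ (hρ f) (hρ _) (hle _) (by rw [hf]; exact hρ' f) (hρ' _)
    (hθ _).1 (hθ _).2

theorem continuousAt_angleSum (hθ : ∀ e, θ e ∈ Set.Ioo 0 π) {κ : ℝ} {ρ : S.Face → ℝ}
    (hρ : ∀ f, 0 < ρ f) (hκρ : ∀ f, κ * ρ f ^ 2 < 1) (f : S.Face) :
    ContinuousAt (fun ρ => S.angleSum κ θ ρ f) ρ := by
  classical
  unfold angleSum
  refine tendsto_finsetSum _ fun e _ => ?_
  refine Tendsto.const_mul 2 ?_
  exact continuous_arccot.continuousAt.comp (continuousAt_cotHalf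
    (continuous_apply _).continuousAt (continuous_apply _).continuousAt (hκρ _) (hρ _)
    (sin_pos_of_pos_of_lt_pi (hθ _).1 (hθ _).2))

theorem exists_leftFace_eq_of_angleSum_pos {κ : ℝ} {ρ : S.Face → ℝ} {f : S.Face}
    (h : 0 < S.angleSum κ θ ρ f) : ∃ e, S.leftFace e = f := by
  classical
  by_contra hcon
  push Not at hcon
  simp [angleSum, hcon] at h

/-- The euclidean angle sums do not change when all radii are scaled. -/
theorem angleSum_zero_mul {c : ℝ} (hc : 0 < c) (ρ : S.Face → ℝ) (f : S.Face) :
    S.angleSum 0 θ (fun f => c * ρ f) f = S.angleSum 0 θ ρ f := by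
  simp only [angleSum, halfAngle_zero_mul hc]

theorem sum_angleSum_zero_univ (hθ : ∀ e, θ e ∈ Set.Ioo 0 π) {ρ : S.Face → ℝ}
    (hρ : ∀ f, 0 < ρ f) :
    ∑ f, S.angleSum 0 θ ρ f = ∑ e ∈ S.incidentEdges Finset.univ, 2 * θ e := by
  classical
  rw [sum_angleSum, sum_incidentEdges]
  refine Finset.sum_congr rfl fun e _ => ?_
  simp only [Finset.mem_univ, if_true]
  exact halfAngle_zero_add (hρ _) (hρ _) (hθ _).1 (hθ _).2

/-! ### Necessity of the inequalities -/

/-- The strict inequality for a set `F'` of faces: it has an incident edge whose contribution to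
the angle sums of `F'` is smaller than `2 * θ`, either because the edge leads out of `F'`, or
because the triangles are hyperbolic. -/
theorem sum_angleSum_lt (hθ : ∀ e, θ e ∈ Set.Ioo 0 π) {κ : ℝ} (hκ : 0 ≤ κ) {ρ : S.Face → ℝ}
    (hρ : ∀ f, 0 < ρ f) (hκρ : ∀ f, κ * ρ f ^ 2 < 1) {F' : Finset S.Face}
    (h : ∃ e, S.leftFace e ∈ F' ∧ (S.leftFace (S.flip e) ∈ F' → 0 < κ)) :
    ∑ f ∈ F', S.angleSum κ θ ρ f < ∑ e ∈ S.incidentEdges F', 2 * θ e := by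
  classical
  obtain ⟨e₀, he₀, he₀'⟩ := h
  rw [sum_angleSum, sum_incidentEdges]
  refine Finset.sum_lt_sum (fun e _ => ?_) ⟨e₀, by simpa using he₀, ?_⟩
  · have h1 := halfAngle_le_zero hκ (hρ (S.leftFace e)) (hρ (S.leftFace (S.flip e))) (hκρ _)
      (hθ (S.edge e)).1 (hθ (S.edge e)).2
    have h2 := halfAngle_le_zero hκ (hρ (S.leftFace (S.flip e))) (hρ (S.leftFace e)) (hκρ _)
      (hθ (S.edge e)).1 (hθ (S.edge e)).2
    have h3 := halfAngle_zero_add (hρ (S.leftFace e)) (hρ (S.leftFace (S.flip e)))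
      (hθ (S.edge e)).1 (hθ (S.edge e)).2
    have h4 := halfAngle_pos 0 (ρ (S.leftFace (S.flip e))) (ρ (S.leftFace e)) (θ (S.edge e))
    split_ifs <;> linarith
  · have h1 := halfAngle_le_zero hκ (hρ (S.leftFace e₀)) (hρ (S.leftFace (S.flip e₀))) (hκρ _)
      (hθ (S.edge e₀)).1 (hθ (S.edge e₀)).2
    have h3 := halfAngle_zero_add (hρ (S.leftFace e₀)) (hρ (S.leftFace (S.flip e₀)))
      (hθ (S.edge e₀)).1 (hθ (S.edge e₀)).2
    have h4 := halfAngle_pos 0 (ρ (S.leftFace (S.flip e₀))) (ρ (S.leftFace e₀)) (θ (S.edge e₀))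
    split_ifs with hm
    · have h5 := halfAngle_lt_zero (he₀' hm) (hρ (S.leftFace e₀)) (hρ (S.leftFace (S.flip e₀)))
        (hκρ _) (hθ (S.edge e₀)).1 (hθ (S.edge e₀)).2
      have h6 := halfAngle_lt_zero (he₀' hm) (hρ (S.leftFace (S.flip e₀))) (hρ (S.leftFace e₀))
        (hκρ _) (hθ (S.edge e₀)).1 (hθ (S.edge e₀)).2
      linarith
    · linarith

/-- A proper nonempty set of faces has an edge leading out of it. -/
theorem exists_flip_notMem {F' : Finset S.Face} (h : F'.Nonempty) (h' : F' ≠ Finset.univ) :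
    ∃ e, S.leftFace e ∈ F' ∧ S.leftFace (S.flip e) ∉ F' := by
  by_contra hcon
  push Not at hcon
  refine h' ?_
  have := S.eq_univ_of_flip_mem (F' : Set S.Face) h hcon
  exact_mod_cast this

/-! ### Behaviour of the angle sums near the boundary -/

/-- When the radii of the faces in `F'` shrink, while the other radii stay away from `0`, the angle
sums over `F'` exhaust the angles of all incident edges: an edge inside `F'` always contributes
`2 * θ`, and the kite of an edge leading out of `F'` has nearly all of its angle at the small
circle. -/
theorem exists_le_sum_angleSum_zero (hθ : ∀ e, θ e ∈ Set.Ioo 0 π) (F' : Finset S.Face)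
    {c ε : ℝ} (hc : 0 < c) (hε : 0 < ε) : ∃ η : ℝ, 0 < η ∧ ∀ ρ : S.Face → ℝ, (∀ f, 0 < ρ f) →
      (∀ f ∈ F', ρ f < η) → (∀ f ∉ F', c ≤ ρ f) →
      ∑ e ∈ S.incidentEdges F', 2 * θ e - ε ≤ ∑ f ∈ F', S.angleSum 0 θ ρ f := by
  classical
  have hs : ∀ e, 0 < sin (θ e) := fun e => sin_pos_of_pos_of_lt_pi (hθ e).1 (hθ e).2
  let w : S.InteriorDart → ℝ := fun e => 2 / (c * sin (θ (S.edge e)))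
  have hw : ∀ e, 0 < w e := fun e => by have := hs (S.edge e); positivity
  let M : ℝ := ∑ e, w e
  have hM : 0 ≤ M := Finset.sum_nonneg fun e _ => (hw e).le
  obtain ⟨η, hη0, hηM⟩ : ∃ η : ℝ, 0 < η ∧ η * M ≤ ε := by
    refine ⟨ε / (M + 1), by positivity, ?_⟩
    rw [div_mul_eq_mul_div, div_le_iff₀ (by positivity)]
    nlinarith
  refine ⟨η, hη0, fun ρ hρ hlt hge => ?_⟩
  have hsum : ∑ e ∈ Finset.univ.filter (fun e => S.leftFace e ∈ F'), η * w e ≤ ε := by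
    rw [← Finset.mul_sum]
    refine le_trans (mul_le_mul_of_nonneg_left ?_ hη0.le) hηM
    exact Finset.sum_le_sum_of_subset_of_nonneg (Finset.filter_subset _ _)
      fun e _ _ => (hw e).le
  rw [sum_angleSum, sum_incidentEdges]
  refine le_trans (sub_le_sub_left hsum _) ?_
  rw [← Finset.sum_sub_distrib]
  refine Finset.sum_le_sum fun e he => ?_
  have he : S.leftFace e ∈ F' := by simpa using he
  split_ifs with hm
  · rw [halfAngle_zero_add (hρ _) (hρ _) (hθ _).1 (hθ _).2]
    have := mul_pos hη0 (hw e)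
    linarith
  · have h1 := le_halfAngle_zero (hρ (S.leftFace e)) (hρ (S.leftFace (S.flip e)))
      (hθ (S.edge e)).1 (hθ (S.edge e)).2
    have h2 : ρ (S.leftFace e) / ρ (S.leftFace (S.flip e)) / sin (θ (S.edge e)) ≤
        η / c / sin (θ (S.edge e)) :=
      div_le_div_of_nonneg_right (div_le_div₀ hη0.le (hlt _ he).le hc (hge _ hm))
        (hs (S.edge e)).le
    have h3 : η * w e = 2 * (η / c / sin (θ (S.edge e))) := by
      simp only [w]
      ring
    linarith

/-- The hyperbolic case follows by comparison, since `le_halfAngle_one` is uniform in the second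
radius. -/
theorem exists_le_sum_angleSum_one (hθ : ∀ e, θ e ∈ Set.Ioo 0 π) (F' : Finset S.Face)
    {c ε : ℝ} (hc : 0 < c) (hε : 0 < ε) : ∃ η : ℝ, 0 < η ∧ ∀ ρ : S.Face → ℝ, (∀ f, 0 < ρ f) →
      (∀ f, ρ f < 1) → (∀ f ∈ F', ρ f < η) → (∀ f ∉ F', c ≤ ρ f) →
      ∑ e ∈ S.incidentEdges F', 2 * θ e - ε ≤ ∑ f ∈ F', S.angleSum 1 θ ρ f := by
  classical
  have hs : ∀ e, 0 < sin (θ e) := fun e => sin_pos_of_pos_of_lt_pi (hθ e).1 (hθ e).2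
  obtain ⟨η₀, hη₀, h⟩ := exists_le_sum_angleSum_zero hθ F' hc (half_pos hε)
  let w : S.InteriorDart → ℝ := fun e => 16 / sin (θ (S.edge e))
  have hw : ∀ e, 0 < w e := fun e => by have := hs (S.edge e); positivity
  let M : ℝ := ∑ f ∈ F', ∑ e ∈ Finset.univ.filter (fun e => S.leftFace e = f), w e
  have hM : 0 ≤ M := Finset.sum_nonneg fun f _ => Finset.sum_nonneg fun e _ => (hw e).le
  let η : ℝ := min (min (1 / 2) (η₀ / 2)) (ε / 2 / (M + 1))
  have hη : 0 < η := by positivity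
  have hη1 : η ≤ 1 / 2 := (min_le_left _ _).trans (min_le_left _ _)
  have hη2 : η ≤ η₀ / 2 := (min_le_left _ _).trans (min_le_right _ _)
  have hη3 : η * M ≤ ε / 2 := by
    have h1 : η * M ≤ ε / 2 / (M + 1) * M := by gcongr; exact min_le_right _ _
    refine h1.trans ?_
    rw [div_mul_eq_mul_div, div_le_iff₀ (by positivity)]
    nlinarith
  refine ⟨η, hη, fun ρ hρ hρ1 hlt hge => ?_⟩
  have hpos : ∀ f, 0 < 1 - ρ f ^ 2 := fun f => by nlinarith [hρ f, hρ1 f]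
  have h1 := h (fun f => ρ f / (1 - ρ f ^ 2)) (fun f => div_pos (hρ f) (hpos f))
    (fun f hf => by
      have := hlt f hf
      have h1 : ρ f ^ 2 ≤ 1 / 4 := by nlinarith [hρ f]
      have h2 : η₀ * ρ f ^ 2 ≤ η₀ * (1 / 4) := by gcongr
      rw [div_lt_iff₀ (hpos f)]
      linarith)
    (fun f hf => by
      refine (hge f hf).trans ?_
      rw [le_div_iff₀ (hpos f)]
      nlinarith [hρ f, sq_nonneg (ρ f)])
  have h2 : ∑ f ∈ F', S.angleSum 0 θ (fun f => ρ f / (1 - ρ f ^ 2)) f - η * M ≤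
      ∑ f ∈ F', S.angleSum 1 θ ρ f := by
    simp only [M, Finset.mul_sum]
    rw [← Finset.sum_sub_distrib]
    refine Finset.sum_le_sum fun f hf => ?_
    unfold angleSum
    rw [← Finset.sum_sub_distrib]
    refine Finset.sum_le_sum fun e he => ?_
    have he : S.leftFace e ∈ F' := by
      have : S.leftFace e = f := by simpa using he
      rwa [this]
    have h3 := le_halfAngle_one (hρ (S.leftFace e)) ((hlt _ he).le.trans hη1)
      (hρ (S.leftFace (S.flip e))) (hρ1 _) (hθ (S.edge e)).1 (hθ (S.edge e)).2
    have h4 : 8 * ρ (S.leftFace e) / sin (θ (S.edge e)) ≤ 8 * η / sin (θ (S.edge e)) := by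
      have := hs (S.edge e)
      have := (hlt _ he).le
      gcongr
    have h5 : η * w e = 2 * (8 * η / sin (θ (S.edge e))) := by simp only [w]; ring
    linarith
  linarith

end CellularSurface

/-! ### Existence of the radii -/

namespace CellularSurface

variable {D : Type*} [Finite D] {S : CellularSurface D} {θ : S.InteriorEdge → ℝ}

theorem exists_angleSum_one_lt (hθ : ∀ e, θ e ∈ Set.Ioo 0 π) {Φ : S.Face → ℝ}
    (hΦ : ∀ f, 0 < Φ f) :
    ∃ R : ℝ, 0 < R ∧ R < 1 ∧ ∀ f, S.angleSum 1 θ (fun _ => R) f < Φ f := by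
  classical
  have h : ∀ᶠ R in 𝓝[<] (1 : ℝ), ∀ f, S.angleSum 1 θ (fun _ => R) f < Φ f := by
    rw [eventually_all]
    intro f
    have : Tendsto (fun R : ℝ => S.angleSum 1 θ (fun _ => R) f) (𝓝[<] 1)
        (𝓝 (∑ e ∈ Finset.univ.filter (fun e => S.leftFace e = f), 2 * 0)) :=
      tendsto_finsetSum _ fun e _ => (tendsto_halfAngle_one (hθ _).1 (hθ _).2).const_mul 2
    simp only [mul_zero, Finset.sum_const_zero] at this
    exact this.eventually (gt_mem_nhds (hΦ f))
  obtain ⟨R, hR, hR'⟩ := (h.and (Ioo_mem_nhdsLT (show (0 : ℝ) < 1 by norm_num))).exists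
  exact ⟨R, hR'.1, hR'.2, hR⟩

theorem exists_angleSum_one_eq (hθ : ∀ e, θ e ∈ Set.Ioo 0 π) {Φ : S.Face → ℝ}
    (hΦ : ∀ f, 0 < Φ f)
    (h : ∀ F' : Finset S.Face, F'.Nonempty →
      ∑ f ∈ F', Φ f < ∑ e ∈ S.incidentEdges F', 2 * θ e) :
    ∃ ρ : S.Face → ℝ, (∀ f, 0 < ρ f) ∧ (∀ f, ρ f < 1) ∧ ∀ f, S.angleSum 1 θ ρ f = Φ f := by
  obtain ⟨R, hR0, hR1, hR⟩ := exists_angleSum_one_lt hθ hΦ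
  have hsq : ∀ r : S.Face → ℝ, (∀ f, 0 < r f) → r ≤ (fun _ => R) → ∀ f, 1 * r f ^ 2 < 1 := by
    intro r hr hrR f
    have h1 : r f ≤ R := hrR f
    nlinarith [hr f]
  obtain ⟨ρ, hρ0, hρR, hρ⟩ := exists_zero_of_supersolution
    (fun ρ f => S.angleSum 1 θ ρ f - Φ f) (fun _ => R) (fun _ => hR0)
    (fun r hr hrR f => (continuousAt_angleSum hθ hr (hsq r hr hrR) f).sub continuousAt_const)
    (fun f r s hr hrs hsR hf => sub_le_sub_right (angleSum_mono hθ zero_le_one hr hrs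
      (hsq s (fun f => (hr f).trans_le (hrs f)) hsR) hf) _)
    (fun f => (sub_neg.2 (hR f)).le)
    (fun A hA c hc => by
      obtain ⟨η, hη, h'⟩ := exists_le_sum_angleSum_one hθ A hc (half_pos (sub_pos.2 (h A hA)))
      refine ⟨η, hη, fun r hr hrR hlt hge => ?_⟩
      have h1 := h' r hr (fun f => (hrR f).trans_lt hR1) hlt hge
      have h2 := h A hA
      have h3 : ∑ f ∈ A, (0 : ℝ) < ∑ f ∈ A, (S.angleSum 1 θ r f - Φ f) := by
        rw [Finset.sum_const_zero, Finset.sum_sub_distrib]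
        linarith
      exact Finset.exists_lt_of_sum_lt h3)
  exact ⟨ρ, hρ0, fun f => (hρR f).trans_lt hR1, fun f => sub_eq_zero.1 (hρ f)⟩

/-- The euclidean equations, perturbed so that large radii give a supersolution. -/
theorem exists_angleSum_zero_eq_add (hθ : ∀ e, θ e ∈ Set.Ioo 0 π) {Φ : S.Face → ℝ}
    (hΦ : ∀ f, 0 < Φ f)
    (h : ∀ F' : Finset S.Face, F'.Nonempty →
      ∑ f ∈ F', Φ f ≤ ∑ e ∈ S.incidentEdges F', 2 * θ e)
    (huniv : ∑ f, Φ f = ∑ e ∈ S.incidentEdges Finset.univ, 2 * θ e) {δ : ℝ} (hδ : 0 < δ) :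
    ∃ ρ : S.Face → ℝ, (∀ f, 0 < ρ f) ∧ ∑ f, ρ f = Fintype.card S.Face ∧
      ∀ f, S.angleSum 0 θ ρ f = Φ f - δ + δ * ρ f := by
  classical
  have hsq : ∀ r : S.Face → ℝ, ∀ f, 0 * r f ^ 2 < 1 := by intro r f; simp
  let M : ℝ := ∑ e : S.InteriorDart, 2 * π
  have hM : ∀ ρ f, S.angleSum 0 θ ρ f ≤ M := by
    intro ρ f
    refine (Finset.sum_le_sum fun e _ => ?_).trans
      (Finset.sum_le_sum_of_subset_of_nonneg (Finset.filter_subset _ _)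
        fun e _ _ => by positivity)
    gcongr
    exact (arccot_lt_pi _).le
  have hM0 : 0 ≤ M := Finset.sum_nonneg fun _ _ => by positivity
  obtain ⟨r, hr0, -, hr⟩ := exists_zero_of_supersolution
    (fun ρ f => S.angleSum 0 θ ρ f - (Φ f - δ + ρ f)) (fun _ => M + δ)
    (fun _ => by positivity)
    (fun r hr _ f => (continuousAt_angleSum hθ hr (hsq r) f).sub
      (continuousAt_const.add (continuous_apply f).continuousAt))
    (fun f r s hr hrs _ hf => by
      have := angleSum_mono hθ le_rfl hr hrs (hsq s) hf
      simp only [hf]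
      linarith)
    (fun f => by
      have h1 := hM (fun _ => M + δ) f
      have h2 := hΦ f
      change S.angleSum 0 θ (fun _ => M + δ) f - (Φ f - δ + (M + δ)) ≤ 0
      linarith)
    (fun A hA c hc => by
      obtain ⟨η, hη, h'⟩ := exists_le_sum_angleSum_zero hθ A hc (show 0 < δ / 4 by positivity)
      refine ⟨min η (δ / 4), by positivity, fun r hr _ hlt hge => ?_⟩
      have h1 := h' r hr (fun f hf => (hlt f hf).trans_le (min_le_left _ _)) hge
      have h2 := h A hA
      have h4 : ∑ f ∈ A, r f ≤ A.card * (δ / 4) := by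
        rw [← nsmul_eq_mul]
        exact Finset.sum_le_card_nsmul _ _ _ fun f hf =>
          (hlt f hf).le.trans (min_le_right _ _)
      have h5 : (1 : ℝ) ≤ A.card := by exact_mod_cast hA.card_pos
      have h3 : ∑ f ∈ A, (0 : ℝ) < ∑ f ∈ A, (S.angleSum 0 θ r f - (Φ f - δ + r f)) := by
        rw [Finset.sum_const_zero, Finset.sum_sub_distrib, Finset.sum_add_distrib,
          Finset.sum_sub_distrib, Finset.sum_const, nsmul_eq_mul]
        nlinarith
      exact Finset.exists_lt_of_sum_lt h3)
  have hr : ∀ f, S.angleSum 0 θ r f = Φ f - δ + r f := fun f => sub_eq_zero.1 (hr f)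
  -- the sum of all equations determines the sum of the radii
  have hsum : ∑ f, r f = Fintype.card S.Face * δ := by
    have h1 := sum_angleSum_zero_univ hθ hr0
    simp only [hr, Finset.sum_add_distrib, Finset.sum_sub_distrib, Finset.sum_const, nsmul_eq_mul,
      Finset.card_univ] at h1
    linarith
  refine ⟨fun f => δ⁻¹ * r f, fun f => mul_pos (inv_pos.2 hδ) (hr0 f), ?_, fun f => ?_⟩
  · rw [← Finset.mul_sum, hsum]
    field_simp
  · rw [angleSum_zero_mul (inv_pos.2 hδ), hr]
    field_simp

/-- A limit of solutions of perturbed equations.  If some, but not all, of the radii tended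
to `0`, the strict inequality for the set of these faces would be violated. -/
theorem exists_angleSum_zero_eq [Nonempty S.Face] (hθ : ∀ e, θ e ∈ Set.Ioo 0 π)
    {Φ : S.Face → ℝ} (hΦ : ∀ f, 0 < Φ f)
    (h : ∀ F' : Finset S.Face, F'.Nonempty →
      ∑ f ∈ F', Φ f ≤ ∑ e ∈ S.incidentEdges F', 2 * θ e ∧
      (∑ f ∈ F', Φ f = ∑ e ∈ S.incidentEdges F', 2 * θ e ↔ F' = Finset.univ)) :
    ∃ ρ : S.Face → ℝ, (∀ f, 0 < ρ f) ∧ ∀ f, S.angleSum 0 θ ρ f = Φ f := by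
  classical
  have huniv := ((h Finset.univ Finset.univ_nonempty).2).2 rfl
  let δ : ℕ → ℝ := fun n => 1 / ((n : ℝ) + 1)
  have hδ : ∀ n, 0 < δ n := fun n => by positivity
  have hδ0 : Tendsto δ atTop (𝓝 0) := tendsto_one_div_add_atTop_nhds_zero_nat
  choose r hr0 hrsum hr using fun n =>
    exists_angleSum_zero_eq_add hθ hΦ (fun F' hF' => (h F' hF').1) huniv (hδ n)
  set N : ℝ := (Fintype.card S.Face : ℝ) with hN
  have hNpos : 0 < N := Nat.cast_pos.2 Fintype.card_pos
  have hrN : ∀ n f, r n f ≤ N := fun n f => by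
    rw [← hrsum n]
    exact Finset.single_le_sum (fun g _ => (hr0 n g).le) (Finset.mem_univ f)
  obtain ⟨s, hs, φ, hφ, hlim⟩ := (isCompact_Icc (a := (0 : S.Face → ℝ))
    (b := fun _ => N)).tendsto_subseq (x := r) (fun n => ⟨fun f => (hr0 n f).le, hrN n⟩)
  have hlimf : ∀ f, Tendsto (fun n => r (φ n) f) atTop (𝓝 (s f)) := fun f =>
    (tendsto_pi_nhds.1 hlim) f
  have hssum : ∑ f, s f = N := by
    refine tendsto_nhds_unique (tendsto_finsetSum _ fun f _ => hlimf f) ?_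
    simp only [hrsum]
    exact tendsto_const_nhds
  have hδφ : Tendsto (fun n => δ (φ n)) atTop (𝓝 0) := hδ0.comp hφ.tendsto_atTop
  have hspos : ∀ f, 0 < s f := by
    by_contra hcon
    push Not at hcon
    obtain ⟨f₀, hf₀⟩ := hcon
    let A : Finset S.Face := Finset.univ.filter fun f => s f ≤ 0
    have hA : A.Nonempty := ⟨f₀, by simpa [A] using hf₀⟩
    have hAu : A ≠ Finset.univ := by
      intro hAu
      have : ∑ f, s f ≤ 0 := Finset.sum_nonpos fun f hf => by
        rw [← hAu] at hf
        simpa [A] using hf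
      linarith
    have hlt : ∑ f ∈ A, Φ f < ∑ e ∈ S.incidentEdges A, 2 * θ e :=
      lt_of_le_of_ne (h A hA).1 fun heq => hAu ((h A hA).2.1 heq)
    obtain ⟨c, hc, hcs⟩ := exists_pos_forall_lt {f | f ∉ A} s (fun f hf => by
      simpa [A] using hf)
    obtain ⟨η, hη, h'⟩ := exists_le_sum_angleSum_zero hθ A hc (half_pos (sub_pos.2 hlt))
    have h1 : ∀ᶠ n in atTop, ∀ f, f ∈ A → r (φ n) f < η := by
      rw [eventually_all]
      intro f
      by_cases hf : f ∈ A
      · have : s f < η := lt_of_le_of_lt (by simpa [A] using hf) hη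
        filter_upwards [(hlimf f).eventually (gt_mem_nhds this)] with n hn _ using hn
      · exact Eventually.of_forall fun n hn => absurd hn hf
    have h2 : ∀ᶠ n in atTop, ∀ f, f ∉ A → c ≤ r (φ n) f := by
      rw [eventually_all]
      intro f
      by_cases hf : f ∈ A
      · exact Eventually.of_forall fun n hn => absurd hf hn
      · filter_upwards [(hlimf f).eventually (lt_mem_nhds (hcs f hf))] with n hn _ using hn.le
    have h3 : Tendsto (fun n => ∑ f ∈ A, (Φ f - δ (φ n) + δ (φ n) * r (φ n) f)) atTop
        (𝓝 (∑ f ∈ A, (Φ f - 0 + 0 * s f))) :=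
      tendsto_finsetSum _ fun f _ => (hδφ.const_sub _).add (hδφ.mul (hlimf f))
    simp only [sub_zero, zero_mul, add_zero] at h3
    have h4 := h3.eventually (gt_mem_nhds
      (show ∑ f ∈ A, Φ f < ∑ e ∈ S.incidentEdges A, 2 * θ e -
        (∑ e ∈ S.incidentEdges A, 2 * θ e - ∑ f ∈ A, Φ f) / 2 by linarith))
    obtain ⟨n, h1, h2, h4⟩ := (h1.and (h2.and h4)).exists
    have h5 := h' (r (φ n)) (hr0 _) h1 h2
    simp only [hr] at h5
    exact absurd h5 (not_le.2 h4)
  refine ⟨s, hspos, fun f => ?_⟩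
  have h1 : Tendsto (fun n => S.angleSum 0 θ (r (φ n)) f) atTop (𝓝 (S.angleSum 0 θ s f)) :=
    (continuousAt_angleSum hθ hspos (fun f => by simp) f).tendsto.comp hlim
  have h2 : Tendsto (fun n => Φ f - δ (φ n) + δ (φ n) * r (φ n) f) atTop
      (𝓝 (Φ f - 0 + 0 * s f)) := (hδφ.const_sub _).add (hδφ.mul (hlimf f))
  simp only [hr] at h1
  simpa using tendsto_nhds_unique h1 h2

/-! ### Uniqueness of the radii -/

theorem exists_max_ratio [Nonempty S.Face] {ρ : S.Face → ℝ} (ρ' : S.Face → ℝ)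
    (hρ : ∀ f, 0 < ρ f) : ∃ c f, ρ' f = c * ρ f ∧ ∀ g, ρ' g ≤ c * ρ g := by
  obtain ⟨f, hf⟩ := Finite.exists_max fun f => ρ' f / ρ f
  refine ⟨ρ' f / ρ f, f, ?_, fun g => ?_⟩
  · rw [div_mul_cancel₀ _ (hρ f).ne']
  · exact (div_le_iff₀ (hρ g)).1 (hf g)

/-- The euclidean maximum principle: the faces where the quotient of two solutions is maximal
form a set that is closed under passing to neighbours. -/
theorem exists_eq_mul_of_angleSum_zero_eq [Nonempty S.Face] (hθ : ∀ e, θ e ∈ Set.Ioo 0 π)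
    {ρ ρ' : S.Face → ℝ} (hρ : ∀ f, 0 < ρ f) (hρ' : ∀ f, 0 < ρ' f)
    (h : ∀ f, S.angleSum 0 θ ρ f = S.angleSum 0 θ ρ' f) :
    ∃ c : ℝ, 0 < c ∧ ∀ f, ρ' f = c * ρ f := by
  classical
  obtain ⟨c, f₀, hf₀, hle⟩ := exists_max_ratio ρ' hρ
  have hc : 0 < c := by
    have := hρ' f₀
    rw [hf₀] at this
    exact pos_of_mul_pos_left this (hρ f₀).le
  refine ⟨c, hc, ?_⟩
  have := S.eq_univ_of_flip_mem {f | ρ' f = c * ρ f} ⟨f₀, hf₀⟩ ?_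
  · exact fun f => (this ▸ Set.mem_univ f : f ∈ {f | ρ' f = c * ρ f})
  intro e₀ he₀
  have he₀ : ρ' (S.leftFace e₀) = c * ρ (S.leftFace e₀) := he₀
  by_contra hne
  have hlt := lt_of_le_of_ne (hle (S.leftFace (S.flip e₀))) hne
  have hsum := h (S.leftFace e₀)
  rw [← angleSum_zero_mul hc] at hsum
  refine absurd hsum (ne_of_gt (Finset.sum_lt_sum (fun e he => ?_) ⟨e₀, by simp, ?_⟩))
  · have he : S.leftFace e = S.leftFace e₀ := by simpa using he
    rw [he, he₀]
    gcongr
    refine halfAngle_mono_right le_rfl (mul_pos hc (hρ _)) (hρ' _) (hle _) (by simp) (by simp)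
      (hθ _).1 (hθ _).2
  · rw [he₀]
    gcongr
    exact arccot_strictAnti (cotHalf_lt_of_lt_right le_rfl (mul_pos hc (hρ _)) (hρ' _) hlt
      (by simp) (by simp) (hθ _).1 (hθ _).2)

/-- The comparison behind the hyperbolic maximum principle. -/
theorem halfAngle_one_lt {c x y y' θ : ℝ} (hc : 1 < c) (hx : 0 < x) (hcx : c * x < 1)
    (hy : 0 < y) (hy1 : y < 1) (hy' : 0 < y') (hy'1 : y' < 1) (hle : y' ≤ c * y)
    (h0 : 0 < θ) (h1 : θ < π) : halfAngle 1 (c * x) y' θ < halfAngle 1 x y θ := by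
  have hx' : 0 < c * x := by positivity
  -- with `d = max 1 (y' / y)`, pass from `(x, y)` to `(d * x, d * y)`, then to `(c * x, d * y)`
  obtain ⟨d, hd1, hdc, hdy, hdy'⟩ : ∃ d : ℝ, 1 ≤ d ∧ d ≤ c ∧ y' ≤ d * y ∧ d * y < 1 := by
    rcases le_total y' y with h | h
    · exact ⟨1, le_rfl, hc.le, by linarith, by linarith⟩
    · refine ⟨y' / y, (one_le_div hy).2 h, (div_le_iff₀ hy).2 hle, ?_, ?_⟩ <;>
      rw [div_mul_cancel₀ _ hy.ne']
      exact hy'1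
  have hd0 : 0 < d := by linarith
  have hdx : d * x ≤ c * x := by gcongr
  have hsq : ∀ z : ℝ, 0 < z → z < 1 → 1 * z ^ 2 < 1 := fun z hz hz1 => by nlinarith
  have hA : halfAngle 1 (c * x) y' θ ≤ halfAngle 1 (c * x) (d * y) θ :=
    halfAngle_mono_right zero_le_one hx' hy' hdy (hsq _ hx' hcx)
      (hsq _ (by positivity) hdy') h0 h1
  have hdx2 : 1 * (d * x) ^ 2 < 1 := hsq _ (by positivity) (by linarith)
  rcases hdc.eq_or_lt with rfl | hlt
  · exact hA.trans_lt (halfAngle_mul_lt one_pos hc hx hy hdx2 h0 h1)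
  · have hB : halfAngle 1 (c * x) (d * y) θ < halfAngle 1 (d * x) (d * y) θ :=
      arccot_strictAnti (cotHalf_one_mono_left (by positivity) (by gcongr) hcx (by positivity)
        h0 h1)
    exact hA.trans_lt (hB.trans_le (halfAngle_mul_le zero_le_one hd1 hx hy hdx2 h0 h1))

theorem le_of_angleSum_one_eq [Nonempty S.Face] (hθ : ∀ e, θ e ∈ Set.Ioo 0 π)
    {Φ ρ ρ' : S.Face → ℝ} (hΦ : ∀ f, 0 < Φ f) (hρ : ∀ f, 0 < ρ f) (hρ1 : ∀ f, ρ f < 1)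
    (hρ' : ∀ f, 0 < ρ' f) (hρ'1 : ∀ f, ρ' f < 1) (h : ∀ f, S.angleSum 1 θ ρ f = Φ f)
    (h' : ∀ f, S.angleSum 1 θ ρ' f = Φ f) : ρ' ≤ ρ := by
  classical
  obtain ⟨c, f₀, hf₀, hle⟩ := exists_max_ratio ρ' hρ
  by_cases hc : c ≤ 1
  · exact fun f => (hle f).trans (mul_le_of_le_one_left (hρ f).le hc)
  push Not at hc
  exfalso
  obtain ⟨e₀, he₀⟩ := exists_leftFace_eq_of_angleSum_pos (by rw [h f₀]; exact hΦ f₀)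
  refine absurd ((h f₀).trans (h' f₀).symm) (ne_of_gt (Finset.sum_lt_sum_of_nonempty
    ⟨e₀, by simpa using he₀⟩ fun e he => ?_))
  have he : S.leftFace e = f₀ := by simpa using he
  rw [he, hf₀]
  gcongr
  exact halfAngle_one_lt hc (hρ _) (by rw [← hf₀]; exact hρ'1 _) (hρ _) (hρ1 _) (hρ' _) (hρ'1 _)
    (hle _) (hθ _).1 (hθ _).2

end CellularSurface

/-! ### The euclidean and the hyperbolic plane in conformal coordinates -/

/-- The properties of the coordinates `dir p` that the euclidean plane (`κ = 0`) and the
hyperbolic plane (`κ = 1`) have in common: `dir p` is a bijection to the plane or to the unit disc,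
the change of the base point is a translation or a Möbius transformation, up to a rotation, and the
distance of `x` from `p` is determined by `‖dir p x‖`.  Similarities with a factor `c` exist only
if `κ * (c ^ 2 - 1) = 0`. -/
structure IsConformalModel (X : Type) [MetricSpace X] [ModelPlane X] (κ : ℝ) : Prop where
  nonneg : 0 ≤ κ
  nonempty : Nonempty X
  sq_lt : ∀ p x : X, κ * ‖dir p x‖ ^ 2 < 1
  exists_dir_eq : ∀ (p : X) (w : ℂ), κ * ‖w‖ ^ 2 < 1 → ∃ x, dir p x = w
  exists_rotation : ∀ p v : X, ∃ u : ℂ, ‖u‖ = 1 ∧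
    ∀ x, dir v x = u * ((dir p x - dir p v) / (1 - κ * (conj (dir p v) * dir p x)))
  norm_dir_eq : ∀ p x q y : X, dist p x = dist q y → ‖dir p x‖ = ‖dir q y‖
  dist_eq_mul : ∀ c : ℝ, 0 < c → κ * (c ^ 2 - 1) = 0 → ∀ p x q y : X,
    ‖dir q y‖ = c * ‖dir p x‖ → dist q y = c * dist p x

theorem isConformalModel_complex : IsConformalModel ℂ 0 where
  nonneg := le_rfl
  nonempty := inferInstance
  sq_lt p x := by simp
  exists_dir_eq p w _ := ⟨p + w, add_sub_cancel_left p w⟩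
  exists_rotation p v := by
    refine ⟨1, by simp, fun x => ?_⟩
    change x - v = 1 * ((x - p - (v - p)) / (1 - ((0 : ℝ) : ℂ) * _))
    simp
  norm_dir_eq p x q y h := by
    change ‖x - p‖ = ‖y - q‖
    rw [← dist_eq_norm, ← dist_eq_norm, dist_comm x, dist_comm y, h]
  dist_eq_mul c _ _ p x q y h := by
    rw [dist_comm q, dist_comm p, dist_eq_norm, dist_eq_norm]
    exact h

namespace UpperHalfPlane

theorem sub_conj_ne_zero (x p : UpperHalfPlane) : (x : ℂ) - conj (p : ℂ) ≠ 0 := by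
  intro h
  have h1 := congrArg Complex.im h
  simp only [Complex.sub_im, Complex.conj_im, Complex.zero_im, coe_im] at h1
  have := x.im_pos
  have := p.im_pos
  linarith

theorem norm_dir (p x : UpperHalfPlane) : ‖dir p x‖ = tanh (dist p x / 2) := by
  rw [dist_comm, tanh_half_dist, Complex.dist_eq, Complex.dist_eq, ← norm_div]
  rfl

theorem norm_dir_lt_one (p x : UpperHalfPlane) : ‖dir p x‖ < 1 := by
  rw [norm_dir]
  exact tanh_lt_one _

end UpperHalfPlane

theorem isConformalModel_upperHalfPlane : IsConformalModel UpperHalfPlane 1 where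
  nonneg := zero_le_one
  nonempty := inferInstance
  sq_lt p x := by
    have h1 := UpperHalfPlane.norm_dir_lt_one p x
    have h2 := norm_nonneg (dir p x)
    nlinarith
  exists_dir_eq p w hw := by
    have hw1 : ‖w‖ ^ 2 < 1 := by simpa using hw
    have hne : 1 - w ≠ 0 := by
      intro h
      have : w = 1 := (sub_eq_zero.1 h).symm
      simp [this] at hw1
    -- the inverse of the Cayley transform
    have him : ((p - conj (p : ℂ) * w) / (1 - w)).im =
        p.im * (1 - ‖w‖ ^ 2) / Complex.normSq (1 - w) := by
      rw [← Complex.normSq_eq_norm_sq, Complex.div_im]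
      have := (Complex.normSq_pos.2 hne).ne'
      simp only [Complex.sub_im, Complex.sub_re, Complex.mul_im, Complex.mul_re, Complex.conj_im,
        Complex.conj_re, UpperHalfPlane.coe_im, UpperHalfPlane.coe_re, Complex.one_re,
        Complex.one_im]
      rw [div_sub_div_same, div_left_inj' this, Complex.normSq_apply]
      ring
    have hpos : 0 < ((p - conj (p : ℂ) * w) / (1 - w)).im := by
      rw [him]
      exact div_pos (mul_pos p.im_pos (by linarith)) (Complex.normSq_pos.2 hne)
    refine ⟨⟨_, hpos⟩, ?_⟩
    change ((p - conj (p : ℂ) * w) / (1 - w) - p) /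
      ((p - conj (p : ℂ) * w) / (1 - w) - conj (p : ℂ)) = w
    have h1 := UpperHalfPlane.sub_conj_ne_zero p p
    have h2 : (p - conj (p : ℂ) * w) / (1 - w) - conj (p : ℂ) = (p - conj (p : ℂ)) / (1 - w) := by
      field_simp
      ring
    rw [h2]
    field_simp
    ring
  exists_rotation p v := by
    have h1 := UpperHalfPlane.sub_conj_ne_zero v p
    have h2 : conj (v : ℂ) - p ≠ 0 := by
      rw [← map_ne_zero (starRingEnd ℂ)]
      simpa using h1
    have h5 := UpperHalfPlane.sub_conj_ne_zero p p
    refine ⟨(v - conj (p : ℂ)) / (p - conj (v : ℂ)), ?_, fun x => ?_⟩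
    · have : p - conj (v : ℂ) = - conj (v - conj (p : ℂ)) := by simp
      rw [norm_div, this, norm_neg, Complex.norm_conj, div_self (norm_ne_zero_iff.2 h1)]
    · have h3 := UpperHalfPlane.sub_conj_ne_zero x p
      have h4 := UpperHalfPlane.sub_conj_ne_zero x v
      have h6 : (p : ℂ) - conj (v : ℂ) ≠ 0 := UpperHalfPlane.sub_conj_ne_zero p v
      change (x - (v : ℂ)) / (x - conj (v : ℂ)) = _ * (((x - (p : ℂ)) / (x - conj (p : ℂ)) -
        (v - (p : ℂ)) / (v - conj (p : ℂ))) / (1 - ((1 : ℝ) : ℂ) *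
        (conj ((v - (p : ℂ)) / (v - conj (p : ℂ))) * ((x - (p : ℂ)) / (x - conj (p : ℂ))))))
      have hA : (x - (p : ℂ)) / (x - conj (p : ℂ)) - (v - (p : ℂ)) / (v - conj (p : ℂ)) =
          (x - v) * (p - conj (p : ℂ)) / ((x - conj (p : ℂ)) * (v - conj (p : ℂ))) := by
        rw [div_sub_div _ _ h3 h1]
        congr 1
        ring
      have hB : 1 - ((1 : ℝ) : ℂ) * (conj ((v - (p : ℂ)) / (v - conj (p : ℂ))) *
          ((x - (p : ℂ)) / (x - conj (p : ℂ)))) =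
          (conj (v : ℂ) - x) * (p - conj (p : ℂ)) / ((conj (v : ℂ) - p) * (x - conj (p : ℂ))) := by
        simp only [map_div₀, map_sub, Complex.conj_conj, Complex.ofReal_one, one_mul]
        field_simp
        ring
      have h7 : conj (v : ℂ) - x ≠ 0 := by
        rw [← neg_ne_zero, neg_sub]; exact h4
      rw [hA, hB]
      field_simp
      ring
  norm_dir_eq p x q y h := by
    rw [UpperHalfPlane.norm_dir, UpperHalfPlane.norm_dir, h]
  dist_eq_mul c hc hc1 p x q y h := by
    have : c = 1 := by nlinarith
    rw [this, one_mul, UpperHalfPlane.norm_dir, UpperHalfPlane.norm_dir] at h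
    have := Real.tanh_injective h
    rw [‹c = 1›]
    linarith

namespace IsConformalModel

variable {X : Type} [MetricSpace X] [ModelPlane X] {κ : ℝ}

theorem dir_self (hX : IsConformalModel X κ) (p : X) : dir p p = 0 := by
  obtain ⟨u, _, hu⟩ := hX.exists_rotation p p
  rw [hu p]
  simp

theorem eq_of_dir_eq (hX : IsConformalModel X κ) {p x y : X} (h : dir p x = dir p y) : x = y := by
  obtain ⟨u, _, hu⟩ := hX.exists_rotation p x
  have h1 : dir x y = 0 := by rw [hu y, h]; simp
  have h2 := hX.dist_eq_mul 1 one_pos (by ring) x x x y (by rw [h1, hX.dir_self]; simp)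
  rw [dist_self, mul_zero, dist_eq_zero] at h2
  exact h2

theorem one_sub_ne_zero (hX : IsConformalModel X κ) (p x y : X) :
    1 - (κ : ℂ) * (conj (dir p x) * dir p y) ≠ 0 := by
  intro h
  have h1 : (κ : ℂ) * (conj (dir p x) * dir p y) = 1 := (sub_eq_zero.1 h).symm
  have h2 := congrArg norm h1
  rw [norm_mul, norm_mul, Complex.norm_conj, Complex.norm_real, norm_of_nonneg hX.nonneg,
    norm_one] at h2
  have h3 := hX.sq_lt p x
  have h4 := hX.sq_lt p y
  nlinarith [mul_nonneg hX.nonneg (sq_nonneg (‖dir p x‖ - ‖dir p y‖))]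

theorem norm_dir_comm (hX : IsConformalModel X κ) (p x : X) : ‖dir p x‖ = ‖dir x p‖ :=
  hX.norm_dir_eq _ _ _ _ (dist_comm _ _)

/-- The two sides of a triangle at the vertex `A`, in terms of those at the vertex `B`. -/
theorem conj_dir_mul_dir (hX : IsConformalModel X κ) (A B C : X) :
    conj (dir A B) * dir A C =
      ((‖dir B A‖ ^ 2 : ℝ) - conj (dir B A) * dir B C) /
        (1 - κ * (conj (dir B A) * dir B C)) := by
  obtain ⟨u, hu1, hu⟩ := hX.exists_rotation B A
  have huu : conj u * u = 1 := by
    rw [mul_comm, Complex.mul_conj, Complex.normSq_eq_norm_sq, hu1]; simp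
  have hvv : conj (dir B A) * dir B A = ((‖dir B A‖ ^ 2 : ℝ) : ℂ) := by
    rw [mul_comm, Complex.mul_conj, Complex.normSq_eq_norm_sq]
  rw [hu B, hu C, hX.dir_self, ← hvv]
  simp only [zero_sub, mul_zero, sub_zero, div_one, map_mul, map_neg]
  rw [mul_mul_mul_comm, huu]
  ring

theorem positivelyOriented_iff (hX : IsConformalModel X κ) (A B C : X) :
    PositivelyOriented A B C ↔ 0 < (conj (dir B C) * dir B A).im := by
  unfold PositivelyOriented
  have hne := hX.one_sub_ne_zero B A C
  have hsq := hX.sq_lt B A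
  have hq : conj (dir B C) * dir B A = conj (conj (dir B A) * dir B C) := by
    simp [mul_comm]
  rw [hX.conj_dir_mul_dir, hq, Complex.conj_im]
  generalize conj (dir B A) * dir B C = q at hne
  generalize ‖dir B A‖ ^ 2 = a at hsq
  have : (((a : ℂ) - q) / (1 - κ * q)).im =
      (1 - κ * a) * (-q.im) / Complex.normSq (1 - κ * q) := by
    rw [Complex.div_im, div_sub_div_same]
    congr 1
    simp
    ring
  rw [this]
  have h1 : 0 < Complex.normSq (1 - κ * q) := Complex.normSq_pos.2 hne
  have h2 : 0 < 1 - κ * a := by linarith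
  constructor
  · intro h
    by_contra hcon
    have : (1 - κ * a) * (-q.im) / Complex.normSq (1 - κ * q) ≤ 0 :=
      div_nonpos_of_nonpos_of_nonneg (mul_nonpos_of_nonneg_of_nonpos h2.le (not_lt.1 hcon)) h1.le
    linarith
  · intro h
    positivity

/-- The similarity of the plane that carries `p` to `q` and is multiplication by `μ` in the
coordinates at these points. -/
theorem exists_similarity (hX : IsConformalModel X κ) (p q : X) {μ : ℂ} (hμ : μ ≠ 0)
    (hκμ : κ * (‖μ‖ ^ 2 - 1) = 0) :
    ∃ g : X ≃ X, g p = q ∧ (∀ x, dir q (g x) = μ * dir p x) ∧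
      (∀ x, ∃ ν : ℂ, ‖ν‖ = ‖μ‖ ∧ ∀ y, dir (g x) (g y) = ν * dir x y) ∧
      ∀ x y, dist (g x) (g y) = ‖μ‖ * dist x y := by
  have hμ0 : 0 < ‖μ‖ := norm_pos_iff.2 hμ
  have hμ2 : κ * ‖μ‖ ^ 2 = κ := by linarith
  have h1 : ∀ x, ∃ y, dir q y = μ * dir p x := fun x => hX.exists_dir_eq q _ (by
    rw [norm_mul, mul_pow, ← mul_assoc, hμ2]
    exact hX.sq_lt p x)
  have h2 : ∀ y, ∃ x, dir p x = μ⁻¹ * dir q y := fun y => hX.exists_dir_eq p _ (by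
    have : κ * ‖μ⁻¹‖ ^ 2 = κ := by
      rw [norm_inv]
      field_simp
      exact hμ2.symm
    rw [norm_mul, mul_pow, ← mul_assoc, this]
    exact hX.sq_lt q y)
  choose g hg using h1
  choose g' hg' using h2
  have hν : ∀ x, ∃ ν : ℂ, ‖ν‖ = ‖μ‖ ∧ ∀ y, dir (g x) (g y) = ν * dir x y := by
    intro x
    obtain ⟨u, hu1, hu⟩ := hX.exists_rotation p x
    obtain ⟨u', hu'1, hu'⟩ := hX.exists_rotation q (g x)
    have hu0 : u ≠ 0 := by
      rw [← norm_ne_zero_iff, hu1]; exact one_ne_zero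
    refine ⟨u' * μ / u, by rw [norm_div, norm_mul, hu1, hu'1]; simp, fun y => ?_⟩
    have hμμ : (κ : ℂ) * (conj (μ * dir p x) * (μ * dir p y)) =
        κ * (conj (dir p x) * dir p y) := by
      have : (κ : ℂ) * (μ * conj μ) = κ := by
        rw [Complex.mul_conj, Complex.normSq_eq_norm_sq]
        exact_mod_cast hμ2
      rw [map_mul]
      linear_combination (conj (dir p x) * dir p y) * this
    rw [hu' (g y), hu y, hg, hg, hμμ]
    field_simp
  refine ⟨⟨g, g', fun x => hX.eq_of_dir_eq (p := p) ?_, fun y => hX.eq_of_dir_eq (p := q) ?_⟩,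
    hX.eq_of_dir_eq (p := q) ?_, hg, hν, fun x y => ?_⟩
  · rw [hg', hg, inv_mul_cancel_left₀ hμ]
  · rw [hg, hg', mul_inv_cancel_left₀ hμ]
  · change dir q (g p) = _
    rw [hg, hX.dir_self, hX.dir_self, mul_zero]
  · obtain ⟨ν, hν1, hν⟩ := hν x
    exact hX.dist_eq_mul _ hμ0 hκμ _ _ _ _ (by
      rw [← hν1, ← norm_mul]
      exact congrArg norm (hν y))

end IsConformalModel

/-! ### Triangles -/

/-- Polar form of `conj v * w`. -/
theorem conj_mul_eq_of_im_pos {v w : ℂ} (h : 0 < (conj v * w).im) :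
    conj v * w = (‖v‖ * ‖w‖ : ℝ) * (cos (InnerProductGeometry.angle v w) +
      sin (InnerProductGeometry.angle v w) * Complex.I) := by
  set α := InnerProductGeometry.angle v w
  have hcos : (‖v‖ * ‖w‖) * cos α = (conj v * w).re := by
    rw [mul_comm, InnerProductGeometry.cos_angle_mul_norm_mul_norm, Complex.inner, mul_comm]
  have hsq : (conj v * w).re ^ 2 + (conj v * w).im ^ 2 = (‖v‖ * ‖w‖) ^ 2 := by
    rw [← Complex.norm_conj v, ← norm_mul, ← Complex.normSq_eq_norm_sq, Complex.normSq_apply]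
    ring
  have hsin : (‖v‖ * ‖w‖) * sin α = (conj v * w).im := by
    have h1 : 0 ≤ (‖v‖ * ‖w‖) * sin α :=
      mul_nonneg (by positivity) (InnerProductGeometry.sin_angle_nonneg _ _)
    rw [← sq_eq_sq₀ h1 h.le]
    rw [← hcos] at hsq
    linear_combination (‖v‖ * ‖w‖) ^ 2 * sin_sq_add_cos_sq α - hsq
  apply Complex.ext
  · rw [← hcos]
    simp [-Complex.ofReal_cos, -Complex.ofReal_sin]
  · rw [← hsin]
    simp [-Complex.ofReal_cos, -Complex.ofReal_sin]

theorem angle_eq_arccot {v w : ℂ} (h : 0 < (conj v * w).im) :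
    InnerProductGeometry.angle v w = arccot ((conj v * w).re / (conj v * w).im) := by
  have h1 := conj_mul_eq_of_im_pos h
  set α := InnerProductGeometry.angle v w
  have hre : (conj v * w).re = (‖v‖ * ‖w‖) * cos α := by
    rw [h1]; simp [-Complex.ofReal_cos, -Complex.ofReal_sin]
  have him : (conj v * w).im = (‖v‖ * ‖w‖) * sin α := by
    rw [h1]; simp [-Complex.ofReal_cos, -Complex.ofReal_sin]
  rw [him] at h
  have hs : 0 < sin α := pos_of_mul_pos_right h (by positivity)
  have hvw : ‖v‖ * ‖w‖ ≠ 0 := by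
    intro h0
    rw [h0, zero_mul] at h
    exact lt_irrefl _ h
  rw [hre, him, mul_div_mul_left _ _ hvw]
  have h0 : 0 < α := lt_of_le_of_ne (InnerProductGeometry.angle_nonneg _ _) (by
    intro h'; rw [← h'] at hs; simp at hs)
  have hπ : α < π := lt_of_le_of_ne (InnerProductGeometry.angle_le_pi _ _) (by
    intro h'; rw [h'] at hs; simp at hs)
  exact (arccot_cos_div_sin h0 hπ).symm

/-- The product `conj (dir A B) * dir A C` for a triangle with sides `x = AB`, `y = BC` and angle
`π - θ` at `B`. -/
noncomputable def sideProd (κ x y θ : ℝ) : ℂ :=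
  ((x ^ 2 : ℝ) + (x * y : ℝ) * (cos θ + sin θ * Complex.I)) /
    (1 + κ * ((x * y : ℝ) * (cos θ + sin θ * Complex.I)))

theorem sideProd_mul {κ c : ℝ} (hc : κ * (c ^ 2 - 1) = 0) (x y θ : ℝ) :
    sideProd κ (c * x) (c * y) θ = (c ^ 2 : ℝ) * sideProd κ x y θ := by
  have h : (κ : ℂ) * c ^ 2 = κ := by
    have : κ * c ^ 2 = κ := by linarith
    exact_mod_cast this
  unfold sideProd
  rw [← mul_div_assoc]
  congr 1
  · push_cast
    ring
  · push_cast
    linear_combination ((x * y : ℂ) * (Complex.cos θ + Complex.sin θ * Complex.I)) * h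

theorem sideProd_re_im {κ x y θ : ℝ}
    (hne : 1 + (κ : ℂ) * ((x * y : ℝ) * (cos θ + sin θ * Complex.I)) ≠ 0) :
    ∃ n : ℝ, 0 < n ∧
      (sideProd κ x y θ).re = x * (x * (1 + κ * y ^ 2) + y * (1 + κ * x ^ 2) * cos θ) / n ∧
      (sideProd κ x y θ).im = x * (y * (1 - κ * x ^ 2) * sin θ) / n := by
  refine ⟨_, Complex.normSq_pos.2 hne, ?_, ?_⟩
  · unfold sideProd
    rw [Complex.div_re, ← add_div]
    congr 1
    simp [-Complex.ofReal_cos, -Complex.ofReal_sin, -Complex.ofReal_mul, -Complex.ofReal_pow]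
    linear_combination (κ * x ^ 2 * y ^ 2) * sin_sq_add_cos_sq θ
  · unfold sideProd
    rw [Complex.div_im, div_sub_div_same]
    congr 1
    simp [-Complex.ofReal_cos, -Complex.ofReal_sin, -Complex.ofReal_mul, -Complex.ofReal_pow]
    ring

/-- The triangle with vertices `A, B, C` in counterclockwise order is half of a kite: the circles
around `A` and `C` through `B`, with radii `x` and `y`, have the interior intersection angle `θ`.
The radii are measured by `‖dir · ·‖`. -/
structure IsHalfKite {X : Type} [MetricSpace X] [ModelPlane X] (x y θ : ℝ) (A B C : X) : Prop where
  oriented : PositivelyOriented A B C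
  norm_left : ‖dir A B‖ = x
  norm_right : ‖dir C B‖ = y
  angle_eq : angleAt B A C = π - θ

namespace IsHalfKite

variable {X : Type} [MetricSpace X] [ModelPlane X] {κ x y θ : ℝ} {A B C : X}

theorem conj_dir_mul_dir_middle (hX : IsConformalModel X κ) (h : IsHalfKite x y θ A B C) :
    conj (dir B C) * dir B A = -((x * y : ℝ) * (cos θ - sin θ * Complex.I)) := by
  have h1 := (hX.positivelyOriented_iff A B C).1 h.oriented
  have h2 := h.angle_eq
  unfold angleAt at h2
  rw [conj_mul_eq_of_im_pos h1, InnerProductGeometry.angle_comm, h2, hX.norm_dir_comm B C,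
    hX.norm_dir_comm B A, h.norm_left, h.norm_right, cos_pi_sub, sin_pi_sub]
  push_cast
  ring

theorem conj_dir_mul_dir_middle' (hX : IsConformalModel X κ) (h : IsHalfKite x y θ A B C) :
    conj (dir B A) * dir B C = -((x * y : ℝ) * (cos θ + sin θ * Complex.I)) := by
  have h1 := congrArg conj (h.conj_dir_mul_dir_middle hX)
  simp only [map_mul, Complex.conj_conj, map_neg, map_sub, Complex.conj_ofReal,
    Complex.conj_I] at h1
  rw [mul_comm, h1]
  ring

theorem denom_ne_zero (hX : IsConformalModel X κ) (h : IsHalfKite x y θ A B C) :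
    1 + (κ : ℂ) * ((x * y : ℝ) * (cos θ + sin θ * Complex.I)) ≠ 0 := by
  have := hX.one_sub_ne_zero B A C
  rwa [h.conj_dir_mul_dir_middle' hX, mul_neg, sub_neg_eq_add] at this

theorem conj_dir_mul_dir_left (hX : IsConformalModel X κ) (h : IsHalfKite x y θ A B C) :
    conj (dir A B) * dir A C = sideProd κ x y θ := by
  rw [hX.conj_dir_mul_dir, h.conj_dir_mul_dir_middle' hX, hX.norm_dir_comm B A, h.norm_left,
    sideProd, mul_neg, sub_neg_eq_add, sub_neg_eq_add]

theorem conj_dir_mul_dir_right (hX : IsConformalModel X κ) (h : IsHalfKite x y θ A B C) :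
    conj (dir C A) * dir C B = sideProd κ y x θ := by
  have h1 : conj (dir C A) * dir C B = conj (conj (dir C B) * dir C A) := by
    simp [mul_comm]
  rw [h1, hX.conj_dir_mul_dir, h.conj_dir_mul_dir_middle hX, hX.norm_dir_comm B C, h.norm_right,
    sideProd, mul_comm y x]
  simp only [map_div₀, map_sub, map_mul, map_neg, Complex.conj_ofReal, map_one, Complex.conj_I]
  congr 1
  · ring
  · ring

theorem sq_lt_right (hX : IsConformalModel X κ) (h : IsHalfKite x y θ A B C) : κ * y ^ 2 < 1 := by
  rw [← h.norm_right]; exact hX.sq_lt _ _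

theorem left_pos (h : IsHalfKite x y θ A B C) : 0 < x := by
  have h1 := h.oriented
  unfold PositivelyOriented at h1
  rw [← h.norm_left, norm_pos_iff]
  intro h0
  rw [h0] at h1
  simp at h1

theorem right_pos (hX : IsConformalModel X κ) (h : IsHalfKite x y θ A B C) : 0 < y := by
  have h1 := (hX.positivelyOriented_iff A B C).1 h.oriented
  rw [← h.norm_right, hX.norm_dir_comm, norm_pos_iff]
  intro h0
  rw [h0] at h1
  simp at h1

theorem dir_ne_zero (h : IsHalfKite x y θ A B C) : dir A C ≠ 0 := by
  have h1 := h.oriented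
  unfold PositivelyOriented at h1
  intro h0
  rw [h0] at h1
  simp at h1

theorem angleAt_left (hX : IsConformalModel X κ) (h : IsHalfKite x y θ A B C) :
    angleAt A B C = halfAngle κ x y θ := by
  obtain ⟨n, hn, hre, him⟩ := sideProd_re_im (h.denom_ne_zero hX)
  have := h.left_pos.ne'
  unfold angleAt halfAngle cotHalf
  rw [angle_eq_arccot h.oriented, h.conj_dir_mul_dir_left hX, hre, him,
    div_div_div_cancel_right₀ hn.ne', mul_div_mul_left _ _ this]

theorem angleAt_right (hX : IsConformalModel X κ) (h0 : 0 < θ) (h1 : θ < π)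
    (h : IsHalfKite x y θ A B C) : angleAt C A B = halfAngle κ y x θ := by
  have hne := h.denom_ne_zero hX
  rw [mul_comm x y] at hne
  obtain ⟨n, hn, hre, him⟩ := sideProd_re_im hne
  have hx := h.left_pos
  have hy := h.right_pos hX
  have hs := sin_pos_of_pos_of_lt_pi h0 h1
  have hy1 : 0 < 1 - κ * y ^ 2 := by linarith [h.sq_lt_right hX]
  have hpos : 0 < (conj (dir C A) * dir C B).im := by
    rw [h.conj_dir_mul_dir_right hX, him]
    positivity
  unfold angleAt halfAngle cotHalf
  rw [angle_eq_arccot hpos, h.conj_dir_mul_dir_right hX, hre, him,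
    div_div_div_cancel_right₀ hn.ne', mul_div_mul_left _ _ hy.ne']

theorem map {g : X → X} (hg : ∀ p, ∃ ν : ℂ, ‖ν‖ = 1 ∧ ∀ q, dir (g p) (g q) = ν * dir p q)
    (h : IsHalfKite x y θ A B C) : IsHalfKite x y θ (g A) (g B) (g C) := by
  obtain ⟨a, ha1, ha⟩ := hg A
  obtain ⟨b, hb1, hb⟩ := hg B
  obtain ⟨c, hc1, hc⟩ := hg C
  have ha2 : conj a * a = 1 := by
    rw [mul_comm, Complex.mul_conj, Complex.normSq_eq_norm_sq, ha1]; simp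
  have hb0 : b ≠ 0 := by
    rw [← norm_ne_zero_iff, hb1]; exact one_ne_zero
  refine ⟨?_, ?_, ?_, ?_⟩
  · unfold PositivelyOriented
    rw [ha, ha, map_mul, mul_mul_mul_comm, ha2, one_mul]
    exact h.oriented
  · rw [ha, norm_mul, ha1, one_mul, h.norm_left]
  · rw [hc, norm_mul, hc1, one_mul, h.norm_right]
  · unfold angleAt
    rw [hb, hb, Complex.angle_mul_left hb0]
    exact h.angle_eq

theorem _root_.IsConformalModel.exists_isHalfKite (hX : IsConformalModel X κ) (hx : 0 < x)
    (hy : 0 < y) (hκx : κ * x ^ 2 < 1) (hκy : κ * y ^ 2 < 1) (h0 : 0 < θ) (h1 : θ < π) :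
    ∃ A B C : X, IsHalfKite x y θ A B C := by
  obtain ⟨B⟩ := hX.nonempty
  have hs := sin_pos_of_pos_of_lt_pi h0 h1
  have hn : ‖(-(x * (cos θ - sin θ * Complex.I)) : ℂ)‖ = x := by
    rw [norm_neg, norm_mul, Complex.norm_real, norm_of_nonneg hx.le]
    have : (cos θ - sin θ * Complex.I : ℂ) = Complex.exp ((-θ : ℝ) * Complex.I) := by
      rw [Complex.exp_mul_I]
      simp [sub_eq_add_neg]
    rw [this, Complex.norm_exp_ofReal_mul_I, mul_one]
  obtain ⟨A, hA⟩ := hX.exists_dir_eq B (-(x * (cos θ - sin θ * Complex.I))) (by rwa [hn])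
  obtain ⟨C, hC⟩ := hX.exists_dir_eq B y (by
    rwa [Complex.norm_real, norm_of_nonneg hy.le])
  have hprod : conj (dir B C) * dir B A =
      ((-(x * y * cos θ) : ℝ) : ℂ) + ((x * y * sin θ : ℝ) : ℂ) * Complex.I := by
    rw [hA, hC, Complex.conj_ofReal]
    push_cast
    ring
  have hre : (conj (dir B C) * dir B A).re = -(x * y * cos θ) := by
    rw [hprod]; simp [-Complex.ofReal_mul, -Complex.ofReal_neg]
  have him : (conj (dir B C) * dir B A).im = x * y * sin θ := by
    rw [hprod]; simp [-Complex.ofReal_mul, -Complex.ofReal_neg]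
  have hpos : 0 < (conj (dir B C) * dir B A).im := by
    rw [him]; positivity
  refine ⟨A, B, C, (hX.positivelyOriented_iff A B C).2 hpos, ?_, ?_, ?_⟩
  · rw [hX.norm_dir_comm, hA, hn]
  · rw [hX.norm_dir_comm, hC, Complex.norm_real, norm_of_nonneg hy.le]
  · unfold angleAt
    rw [InnerProductGeometry.angle_comm, angle_eq_arccot hpos, hre, him, ← mul_neg,
      mul_div_mul_left _ _ (by positivity), ← cos_pi_sub, ← sin_pi_sub,
      arccot_cos_div_sin (by linarith) (by linarith)]

/-- Two congruent triangles can be joined to a kite. -/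
theorem _root_.IsConformalModel.exists_kite (hX : IsConformalModel X κ) (hx : 0 < x)
    (hy : 0 < y) (hκx : κ * x ^ 2 < 1) (hκy : κ * y ^ 2 < 1) (h0 : 0 < θ) (h1 : θ < π) :
    ∃ A B C B' : X, IsHalfKite x y θ A B C ∧ IsHalfKite y x θ C B' A := by
  obtain ⟨A, B, C, h⟩ := hX.exists_isHalfKite hx hy hκx hκy h0 h1
  obtain ⟨C₀, B₀, A₀, h'⟩ := hX.exists_isHalfKite hy hx hκy hκx h0 h1
  have hne := h.dir_ne_zero
  have hnorm : ‖dir A C‖ = ‖dir A₀ C₀‖ := by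
    have e1 := congrArg norm (h.conj_dir_mul_dir_left hX)
    have e2 := congrArg norm (h'.conj_dir_mul_dir_right hX)
    rw [norm_mul, Complex.norm_conj, h.norm_left] at e1
    rw [norm_mul, Complex.norm_conj, h'.norm_right, ← e1, mul_comm] at e2
    exact (mul_left_cancel₀ hx.ne' e2).symm
  have hne' : dir A₀ C₀ ≠ 0 := by
    rw [← norm_ne_zero_iff, ← hnorm, norm_ne_zero_iff]; exact hne
  have hμ1 : ‖dir A C / dir A₀ C₀‖ = 1 := by
    rw [norm_div, hnorm, div_self (norm_ne_zero_iff.2 hne')]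
  obtain ⟨g, hgA, hg, hg', -⟩ := hX.exists_similarity A₀ A (div_ne_zero hne hne')
    (by rw [hμ1]; ring)
  have hgC : g C₀ = C := hX.eq_of_dir_eq (p := A) (by rw [hg, div_mul_cancel₀ _ hne'])
  refine ⟨A, B, C, g B₀, h, ?_⟩
  rw [hμ1] at hg'
  have := h'.map hg'
  rwa [hgA, hgC] at this

/-- Two kites whose radii have the same ratio `c` are similar. -/
theorem exists_similarity (hX : IsConformalModel X κ) {c : ℝ} (hc : 0 < c)
    (hκc : κ * (c ^ 2 - 1) = 0) {B' A₂ B₂ C₂ B₂' : X}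
    (h : IsHalfKite x y θ A B C) (h' : IsHalfKite y x θ C B' A)
    (h₂ : IsHalfKite (c * x) (c * y) θ A₂ B₂ C₂) (h₂' : IsHalfKite (c * y) (c * x) θ C₂ B₂' A₂) :
    ∃ g : X ≃ X, (∀ p q, dist (g p) (g q) = c * dist p q) ∧
      g A = A₂ ∧ g B = B₂ ∧ g C = C₂ ∧ g B' = B₂' := by
  have hne := h.dir_ne_zero
  have hne₂ := h₂.dir_ne_zero
  have e := h.conj_dir_mul_dir_left hX
  have e₂ := h₂.conj_dir_mul_dir_left hX
  have e' := h'.conj_dir_mul_dir_right hX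
  have e₂' := h₂'.conj_dir_mul_dir_right hX
  rw [sideProd_mul hκc, ← e] at e₂
  rw [sideProd_mul hκc, ← e'] at e₂'
  have hB : ‖dir A B‖ = x := h.norm_left
  have hB₂ : ‖dir A₂ B₂‖ = c * x := h₂.norm_left
  have hnorm : ‖dir A₂ C₂‖ = c * ‖dir A C‖ := by
    have := congrArg norm e₂
    rw [norm_mul, norm_mul, norm_mul, Complex.norm_conj, Complex.norm_conj, hB, hB₂,
      Complex.norm_real, norm_of_nonneg (by positivity)] at this
    have hcx : c * x ≠ 0 := mul_ne_zero hc.ne' h.left_pos.ne'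
    apply mul_left_cancel₀ hcx
    rw [this]
    ring
  have hsq : ∀ z : ℂ, conj z * z = ((‖z‖ ^ 2 : ℝ) : ℂ) := fun z => by
    rw [mul_comm, Complex.mul_conj, Complex.normSq_eq_norm_sq]
  have hμ : ‖dir A₂ C₂ / dir A C‖ = c := by
    rw [norm_div, hnorm, mul_div_cancel_right₀ _ (norm_ne_zero_iff.2 hne)]
  obtain ⟨g, hgA, hg, -, hdist⟩ := hX.exists_similarity A A₂ (div_ne_zero hne₂ hne)
    (by rw [hμ]; exact hκc)
  rw [hμ] at hdist
  refine ⟨g, hdist, hgA, hX.eq_of_dir_eq (p := A₂) ?_, hX.eq_of_dir_eq (p := A₂) ?_,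
    hX.eq_of_dir_eq (p := A₂) ?_⟩
  · rw [hg, div_mul_eq_mul_div, div_eq_iff hne]
    have hz : dir A₂ B₂ ≠ 0 := by
      rw [← norm_ne_zero_iff, hB₂]; exact mul_ne_zero hc.ne' h.left_pos.ne'
    apply mul_left_cancel₀ ((map_ne_zero (starRingEnd ℂ)).2 hz)
    rw [← mul_assoc, e₂]
    have h3 := hsq (dir A B)
    have h4 := hsq (dir A₂ B₂)
    rw [hB] at h3
    rw [hB₂] at h4
    push_cast at h3 h4 ⊢
    linear_combination (c ^ 2 * dir A C) * h3 - dir A C * h4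
  · rw [hg, div_mul_cancel₀ _ hne]
  · rw [hg, div_mul_eq_mul_div, div_eq_iff hne]
    apply mul_left_cancel₀ ((map_ne_zero (starRingEnd ℂ)).2 hne₂)
    rw [← mul_assoc, ← mul_assoc, e₂', hsq, hnorm]
    have h3 := hsq (dir A C)
    push_cast at h3 ⊢
    linear_combination (-(c ^ 2 * dir A B')) * h3

end IsHalfKite

/-! ### Circle patterns and radii -/

namespace CirclePattern

variable {X : Type} [MetricSpace X] [ModelPlane X] {D : Type*} {S : CellularSurface D} {κ : ℝ}
  {θ : S.InteriorEdge → ℝ} {Φ ρ : S.Face → ℝ}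

/-- The quadrilaterals of the pattern `P` are kites with intersection angles `θ` and radii `ρ`,
where the radii are measured by `‖dir · ·‖`. -/
def HasRadii (P : CirclePattern X S) (θ : S.InteriorEdge → ℝ) (ρ : S.Face → ℝ) : Prop :=
  ∀ e, IsHalfKite (ρ (S.leftFace e)) (ρ (S.leftFace (S.flip e))) (θ (S.edge e))
    (P.center e) (P.corner e) (P.center (S.flip e))

theorem HasRadii.flip {P : CirclePattern X S} (h : P.HasRadii θ ρ) (e : S.InteriorDart) :
    IsHalfKite (ρ (S.leftFace (S.flip e))) (ρ (S.leftFace e)) (θ (S.edge e))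
      (P.center (S.flip e)) (P.corner (S.flip e)) (P.center e) := by
  simpa using h (S.flip e)

theorem HasRadii.hasData_iff [Finite D] (hX : IsConformalModel X κ)
    (hθ : ∀ e, θ e ∈ Set.Ioo 0 π) {P : CirclePattern X S} (h : P.HasRadii θ ρ) :
    P.HasData θ Φ ↔ ∀ f, S.angleSum κ θ ρ f = Φ f := by
  have hangle : ∀ e, P.interiorIntersectionAngle e = θ (S.edge e) := fun e => by
    have := (h e).angle_eq
    unfold interiorIntersectionAngle
    linarith
  have hcenter : ∀ e, P.centerAngle e =
      2 * halfAngle κ (ρ (S.leftFace e)) (ρ (S.leftFace (S.flip e))) (θ (S.edge e)) := fun e => by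
    unfold centerAngle
    rw [(h e).angleAt_left hX, (h.flip e).angleAt_right hX (hθ _).1 (hθ _).2]
    ring
  unfold HasData CellularSurface.angleSum
  simp only [hcenter]
  exact ⟨fun h => h.2, fun h => ⟨hangle, h⟩⟩

/-- The radii of a circle pattern.  Every face has an interior edge, since the angles at its white
vertex have a positive sum. -/
theorem exists_hasRadii [Finite D] (hX : IsConformalModel X κ) (hΦ : ∀ f, 0 < Φ f)
    {P : CirclePattern X S} (hP : P.HasData θ Φ) :
    ∃ ρ : S.Face → ℝ, (∀ f, 0 < ρ f) ∧ (∀ f, κ * ρ f ^ 2 < 1) ∧ P.HasRadii θ ρ := by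
  classical
  have hface : ∀ f, ∃ e, S.leftFace e = f := by
    intro f
    by_contra hcon
    push Not at hcon
    have h1 := hP.2 f
    rw [Finset.filter_false_of_mem (fun e _ => hcon e), Finset.sum_empty] at h1
    exact (hΦ f).ne h1
  choose E hE using hface
  obtain ⟨r, hr⟩ := P.equal_lengths
  let ρ : S.Face → ℝ := fun f => ‖dir (P.center (E f)) (P.corner (E f))‖
  have hρ : ∀ e, ‖dir (P.center e) (P.corner e)‖ = ρ (S.leftFace e) := fun e =>
    hX.norm_dir_eq _ _ _ _ (by rw [(hr e).1, (hr _).1, hE])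
  have hρ' : ∀ e, ‖dir (P.center (S.flip e)) (P.corner e)‖ = ρ (S.leftFace (S.flip e)) := by
    intro e
    refine hX.norm_dir_eq _ _ _ _ ?_
    have := (hr (S.flip e)).2
    rw [S.flip_flip] at this
    rw [this, (hr _).1, hE]
  have hkite : P.HasRadii θ ρ := fun e => ⟨P.oriented e, hρ e, hρ' e, by
    have := hP.1 e
    unfold interiorIntersectionAngle at this
    linarith⟩
  refine ⟨ρ, fun f => ?_, fun f => hX.sq_lt _ _, hkite⟩
  have := (hkite (E f)).left_pos
  rwa [hE] at this

theorem _root_.IsConformalModel.exists_circlePattern (hX : IsConformalModel X κ)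
    (hθ : ∀ e, θ e ∈ Set.Ioo 0 π) (hρ : ∀ f, 0 < ρ f) (hκρ : ∀ f, κ * ρ f ^ 2 < 1) :
    ∃ P : CirclePattern X S, P.HasRadii θ ρ := by
  classical
  -- one kite for each edge, placed with respect to a chosen orientation of the edge
  let o : S.InteriorEdge → S.InteriorDart := Quotient.out
  have ho : ∀ E, S.edge (o E) = E := fun E => Quotient.out_eq E
  choose A B C B' hT hT' using fun E : S.InteriorEdge =>
    hX.exists_kite (hρ (S.leftFace (o E))) (hρ (S.leftFace (S.flip (o E)))) (hκρ _) (hκρ _)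
      (hθ E).1 (hθ E).2
  let cen : S.InteriorDart → X := fun e => if e = o (S.edge e) then A (S.edge e) else C (S.edge e)
  let cor : S.InteriorDart → X := fun e => if e = o (S.edge e) then B (S.edge e) else B' (S.edge e)
  have hkite : ∀ e, IsHalfKite (ρ (S.leftFace e)) (ρ (S.leftFace (S.flip e))) (θ (S.edge e))
      (cen e) (cor e) (cen (S.flip e)) := by
    intro e
    by_cases he : e = o (S.edge e)
    · have hf : S.flip e ≠ o (S.edge e) := fun h => S.flip_ne e (h.trans he.symm)
      have := hT (S.edge e)
      rw [← he] at this
      simp only [cen, cor, S.edge_flip, if_pos he, if_neg hf]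
      exact this
    · have hf : S.flip e = o (S.edge e) := by
        rcases S.edge_eq_iff.1 (ho (S.edge e)) with h | h
        · exact absurd h.symm he
        · exact h.symm
      have := hT' (S.edge e)
      rw [← hf, S.flip_flip] at this
      simp only [cen, cor, S.edge_flip, if_neg he, if_pos hf]
      exact this
  have hnorm : ∀ f, ∃ d : ℝ, ∀ p x : X, ‖dir p x‖ = ρ f → dist p x = d := by
    intro f
    obtain ⟨p⟩ := hX.nonempty
    obtain ⟨x, hx⟩ := hX.exists_dir_eq p (ρ f) (by
      rw [Complex.norm_real, norm_of_nonneg (hρ f).le]; exact hκρ f)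
    refine ⟨dist p x, fun q y hy => ?_⟩
    rw [hX.dist_eq_mul 1 one_pos (by ring) p x q y (by
      rw [hy, hx, Complex.norm_real, norm_of_nonneg (hρ f).le, one_mul]), one_mul]
  choose r hr using hnorm
  refine ⟨⟨cen, cor, fun e => (hkite e).oriented, r, fun e => ⟨hr _ _ _ (hkite e).norm_left,
    hr _ _ _ ?_⟩⟩, hkite⟩
  have := (hkite (S.flip e)).norm_right
  rwa [S.flip_flip] at this

theorem exists_hasData_iff [Finite D] (hX : IsConformalModel X κ) (hθ : ∀ e, θ e ∈ Set.Ioo 0 π)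
    (hΦ : ∀ f, 0 < Φ f) :
    (∃ P : CirclePattern X S, P.HasData θ Φ) ↔
      ∃ ρ : S.Face → ℝ, (∀ f, 0 < ρ f) ∧ (∀ f, κ * ρ f ^ 2 < 1) ∧
        ∀ f, S.angleSum κ θ ρ f = Φ f := by
  constructor
  · rintro ⟨P, hP⟩
    obtain ⟨ρ, h0, h1, h⟩ := exists_hasRadii hX hΦ hP
    exact ⟨ρ, h0, h1, (h.hasData_iff hX hθ).1 hP⟩
  · rintro ⟨ρ, h0, h1, h⟩
    obtain ⟨P, hP⟩ := hX.exists_circlePattern (S := S) hθ h0 h1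
    exact ⟨P, (hP.hasData_iff hX hθ).2 h⟩

/-! ### Similar patterns -/

section Similar

variable {c : ℝ} {g : X ≃ X}

theorem mem_seg_iff_of_dist_eq {X : Type} [MetricSpace X] {g : X ≃ X} (hc : 0 < c)
    (hg : ∀ x y, dist (g x) (g y) = c * dist x y) (x y z : X) :
    g z ∈ seg (g x) (g y) ↔ z ∈ seg x y := by
  simp only [seg, Set.mem_ofPred_eq, hg, ← mul_add]
  exact mul_right_inj' hc.ne'

theorem mem_triangle_iff_of_dist_eq {X : Type} [MetricSpace X] {g : X ≃ X} (hc : 0 < c)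
    (hg : ∀ x y, dist (g x) (g y) = c * dist x y) (x y z p : X) :
    g p ∈ triangle (g x) (g y) (g z) ↔ p ∈ triangle x y z := by
  simp only [triangle, Set.mem_ofPred_eq]
  rw [← g.exists_congr_right]
  simp only [mem_seg_iff_of_dist_eq hc hg]

theorem pathLength_map {P Q : CirclePattern X S} (hc : 0 < c) {A : S.InteriorDart → X ≃ X}
    (hA : ∀ e x y, dist (A e x) (A e y) = c * dist x y)
    (hquad : ∀ e x, A e x ∈ Q.quad e ↔ x ∈ P.quad e) {T : P.Surface → Q.Surface}
    (hT : ∀ e (x : P.quad e), T (P.toSurface e x) = Q.toSurface e ⟨A e x, (hquad e x).2 x.2⟩)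
    {p q : P.Surface} {l : ℝ} (h : P.PathLength p q l) : Q.PathLength (T p) (T q) (c * l) := by
  induction h with
  | refl p => rw [mul_zero]; exact PathLength.refl _
  | step e x y q l hseg _ ih =>
    rw [hT, mul_add, ← hA e]
    refine PathLength.step e ⟨A e x, (hquad e x).2 x.2⟩ ⟨A e y, (hquad e y).2 y.2⟩ _ _ ?_ ?_
    · intro z hz
      obtain ⟨z, rfl⟩ := (A e).surjective z
      exact (hquad e z).2 (hseg ((mem_seg_iff_of_dist_eq hc (hA e) _ _ _).1 hz))
    · rw [← hT]; exact ih

/-- Similarities of the quadrilaterals that respect the vertices fit together to a similarity of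
the surfaces. -/
theorem similarBy_of_forall_edge {P Q : CirclePattern X S} (hc : 0 < c)
    (A : S.InteriorEdge → X ≃ X) (hA : ∀ E x y, dist (A E x) (A E y) = c * dist x y)
    (hcen : ∀ e, A (S.edge e) (P.center e) = Q.center e)
    (hcor : ∀ e, A (S.edge e) (P.corner e) = Q.corner e) : SimilarBy c P Q := by
  have hcen' : ∀ e, A (S.edge e) (P.center (S.flip e)) = Q.center (S.flip e) := fun e => by
    rw [← hcen, S.edge_flip]
  have hcor' : ∀ e, A (S.edge e) (P.corner (S.flip e)) = Q.corner (S.flip e) := fun e => by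
    rw [← hcor, S.edge_flip]
  have hquad : ∀ e x, A (S.edge e) x ∈ Q.quad e ↔ x ∈ P.quad e := fun e x => by
    unfold quad
    rw [← hcen, ← hcor, ← hcen', ← hcor']
    simp only [Set.mem_union, mem_triangle_iff_of_dist_eq hc (hA _)]
  let φ : (Σ e : S.InteriorDart, P.quad e) ≃ Σ e : S.InteriorDart, Q.quad e :=
    Equiv.sigmaCongrRight fun e => (A (S.edge e)).subtypeEquiv fun x => (hquad e x).symm
  have hglue : ∀ p q, P.Glue p q ↔ Q.Glue (φ p) (φ q) := by
    rintro ⟨e, x⟩ ⟨e', x'⟩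
    change ((e' = S.flip e ∧ (x' : X) = x) ∨ (e'.1 = S.σ e.1 ∧
        (x : X) ∈ seg (P.center e) (P.corner (S.flip e)) ∧
        (x' : X) ∈ seg (P.center e') (P.corner e') ∧
        dist (P.center e) x = dist (P.center e') x') ∨
        (S.leftFace e = S.leftFace e' ∧ (x : X) = P.center e ∧ (x' : X) = P.center e')) ↔
      ((e' = S.flip e ∧ A (S.edge e') x' = A (S.edge e) x) ∨ (e'.1 = S.σ e.1 ∧
        A (S.edge e) x ∈ seg (Q.center e) (Q.corner (S.flip e)) ∧
        A (S.edge e') x' ∈ seg (Q.center e') (Q.corner e') ∧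
        dist (Q.center e) (A (S.edge e) x) = dist (Q.center e') (A (S.edge e') x')) ∨
        (S.leftFace e = S.leftFace e' ∧ A (S.edge e) x = Q.center e ∧
          A (S.edge e') x' = Q.center e'))
    refine or_congr (and_congr_right fun h => ?_) (or_congr ?_ ?_)
    · rw [show S.edge e' = S.edge e by rw [h, S.edge_flip]]
      exact (A _).injective.eq_iff.symm
    · rw [← hcen, ← hcor', ← hcen e', ← hcor e', mem_seg_iff_of_dist_eq hc (hA _),
        mem_seg_iff_of_dist_eq hc (hA _), hA, hA, mul_right_inj' hc.ne']
    · rw [← hcen, ← hcen e', (A _).injective.eq_iff, (A _).injective.eq_iff]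
  let T : P.Surface ≃ Q.Surface := Quot.congr φ hglue
  have hT : ∀ e (x : P.quad e),
      T (P.toSurface e x) = Q.toSurface e ⟨A (S.edge e) x, (hquad e x).2 x.2⟩ := fun e x => rfl
  have hquad' : ∀ e x, (A (S.edge e)).symm x ∈ P.quad e ↔ x ∈ Q.quad e := fun e x => by
    rw [← hquad, Equiv.apply_symm_apply]
  have hT' : ∀ e (x : Q.quad e), T.symm (Q.toSurface e x) =
      P.toSurface e ⟨(A (S.edge e)).symm x, (hquad' e x).2 x.2⟩ := fun e x => by
    rw [Equiv.symm_apply_eq, hT]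
    simp
  have hA' : ∀ e x y, dist ((A (S.edge e)).symm x) ((A (S.edge e)).symm y) = c⁻¹ * dist x y := by
    intro e x y
    have := hA (S.edge e) ((A (S.edge e)).symm x) ((A (S.edge e)).symm y)
    rw [Equiv.apply_symm_apply, Equiv.apply_symm_apply] at this
    rw [this, inv_mul_cancel_left₀ hc.ne']
  refine ⟨T, fun p q => ?_, fun e => ⟨A (S.edge e), hA _, hcen e, hcor e, hcen' e, hcor' e,
    fun x => ⟨(hquad e x).2 x.2, hT e x⟩⟩⟩
  unfold surfaceDist
  rw [← smul_eq_mul, ← Real.sInf_smul_of_nonneg hc.le]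
  congr 1
  ext l
  rw [Set.mem_smul_set_iff_inv_smul_mem₀ hc.ne', Set.mem_ofPred_eq, Set.mem_ofPred_eq,
    smul_eq_mul]
  constructor
  · intro h
    have := pathLength_map (A := fun e => (A (S.edge e)).symm) (inv_pos.2 hc) hA' hquad' hT' h
    rwa [T.symm_apply_apply, T.symm_apply_apply] at this
  · intro h
    have := pathLength_map (A := fun e => A (S.edge e)) hc (fun e => hA _) hquad hT h
    rwa [mul_inv_cancel_left₀ hc.ne'] at this

theorem similarBy_of_hasRadii (hX : IsConformalModel X κ) (hc : 0 < c)
    (hκc : κ * (c ^ 2 - 1) = 0) {P Q : CirclePattern X S} (hP : P.HasRadii θ ρ)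
    (hQ : Q.HasRadii θ fun f => c * ρ f) : SimilarBy c P Q := by
  let o : S.InteriorEdge → S.InteriorDart := Quotient.out
  have ho : ∀ E, S.edge (o E) = E := fun E => Quotient.out_eq E
  choose A hA h1 h2 h3 h4 using fun E => IsHalfKite.exists_similarity hX hc hκc (hP (o E))
    (hP.flip (o E)) (hQ (o E)) (hQ.flip (o E))
  refine similarBy_of_forall_edge hc A hA (fun e => ?_) (fun e => ?_)
  · rcases S.edge_eq_iff.1 (ho (S.edge e)).symm with h | h
    · have := h1 (S.edge e)
      rwa [← h] at this
    · have := h3 (S.edge e)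
      rwa [← h] at this
  · rcases S.edge_eq_iff.1 (ho (S.edge e)).symm with h | h
    · have := h2 (S.edge e)
      rwa [← h] at this
    · have := h4 (S.edge e)
      rwa [← h] at this

end Similar

end CirclePattern

end

theorem mainTheorem1 {D : Type*} [Finite D] [Nonempty D] (S : CellularSurface D)
    (θ' : S.InteriorEdge → ℝ) (hθ' : ∀ e, θ' e ∈ Set.Ioo 0 Real.pi)
    (Φ : S.Face → ℝ) (hΦ : ∀ f, 0 < Φ f) :
    -- (i) euclidean circle patterns
    (((∃ P : CirclePattern ℂ S, P.HasData θ' Φ) ↔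
        ∀ F' : Finset S.Face, F'.Nonempty →
          ∑ f ∈ F', Φ f ≤ ∑ e ∈ S.incidentEdges F', 2 * θ' e ∧
          (∑ f ∈ F', Φ f = ∑ e ∈ S.incidentEdges F', 2 * θ' e ↔ F' = Finset.univ)) ∧
      ∀ P Q : CirclePattern ℂ S, P.HasData θ' Φ → Q.HasData θ' Φ → P.Similar Q) ∧
    -- (ii) hyperbolic circle patterns
    (((∃ P : CirclePattern UpperHalfPlane S, P.HasData θ' Φ) ↔
        ∀ F' : Finset S.Face, F'.Nonempty →
          ∑ f ∈ F', Φ f < ∑ e ∈ S.incidentEdges F', 2 * θ' e) ∧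
      ∀ P Q : CirclePattern UpperHalfPlane S,
        P.HasData θ' Φ → Q.HasData θ' Φ → P.Isometric Q) := by
  classical
  have := S.nonempty_face
  have hE := isConformalModel_complex
  have hH := isConformalModel_upperHalfPlane
  refine ⟨⟨?_, fun P Q hP hQ => ?_⟩, ⟨?_, fun P Q hP hQ => ?_⟩⟩
  · rw [CirclePattern.exists_hasData_iff hE hθ' hΦ]
    constructor
    · rintro ⟨ρ, hρ, hρ1, h⟩ F' hF'
      by_cases hu : F' = Finset.univ
      · subst hu
        have := CellularSurface.sum_angleSum_zero_univ hθ' hρ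
        simp only [h] at this
        exact ⟨this.le, fun _ => rfl, fun _ => this⟩
      · obtain ⟨e, he, he'⟩ := CellularSurface.exists_flip_notMem hF' hu
        have := CellularSurface.sum_angleSum_lt hθ' le_rfl hρ hρ1
          ⟨e, he, fun hm => absurd hm he'⟩
        simp only [h] at this
        exact ⟨this.le, fun heq => absurd heq this.ne, fun hu' => absurd hu' hu⟩
    · intro h
      obtain ⟨ρ, hρ, hsum⟩ := CellularSurface.exists_angleSum_zero_eq hθ' hΦ h
      exact ⟨ρ, hρ, fun f => by simp, hsum⟩
  · obtain ⟨ρ, hρ, -, hPρ⟩ := CirclePattern.exists_hasRadii hE hΦ hP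
    obtain ⟨ρ', hρ', -, hQρ⟩ := CirclePattern.exists_hasRadii hE hΦ hQ
    obtain ⟨c, hc, hcρ⟩ := CellularSurface.exists_eq_mul_of_angleSum_zero_eq hθ' hρ hρ' fun f => by
      rw [(hPρ.hasData_iff hE hθ').1 hP, (hQρ.hasData_iff hE hθ').1 hQ]
    obtain rfl : ρ' = fun f => c * ρ f := funext hcρ
    exact ⟨c, hc, CirclePattern.similarBy_of_hasRadii hE hc (by ring) hPρ hQρ⟩
  · rw [CirclePattern.exists_hasData_iff hH hθ' hΦ]
    constructor
    · rintro ⟨ρ, hρ, hρ1, h⟩ F' ⟨f, hf⟩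
      obtain ⟨e, he⟩ := CellularSurface.exists_leftFace_eq_of_angleSum_pos (by rw [h f]; exact hΦ f)
      have := CellularSurface.sum_angleSum_lt hθ' zero_le_one hρ hρ1 (F' := F')
        ⟨e, by rwa [he], fun _ => one_pos⟩
      simpa only [h] using this
    · intro h
      obtain ⟨ρ, hρ, hρ1, hsum⟩ := CellularSurface.exists_angleSum_one_eq hθ' hΦ h
      exact ⟨ρ, hρ, fun f => by nlinarith [hρ f, hρ1 f], hsum⟩
  · obtain ⟨ρ, hρ, hρ1, hPρ⟩ := CirclePattern.exists_hasRadii hH hΦ hP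
    obtain ⟨ρ', hρ', hρ'1, hQρ⟩ := CirclePattern.exists_hasRadii hH hΦ hQ
    have h := (hPρ.hasData_iff hH hθ').1 hP
    have h' := (hQρ.hasData_iff hH hθ').1 hQ
    have hρ1 : ∀ f, ρ f < 1 := fun f => by nlinarith [hρ1 f, hρ f]
    have hρ'1 : ∀ f, ρ' f < 1 := fun f => by nlinarith [hρ'1 f, hρ' f]
    obtain rfl : ρ' = ρ := le_antisymm
      (CellularSurface.le_of_angleSum_one_eq hθ' hΦ hρ hρ1 hρ' hρ'1 h h')
      (CellularSurface.le_of_angleSum_one_eq hθ' hΦ hρ' hρ'1 hρ hρ1 h' h)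
    exact CirclePattern.similarBy_of_hasRadii hH one_pos (by ring) hPρ (by simpa using hQρ)
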